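/- Fix $p\in(0,1)$. Let $m=m(n)\ge 1$ and $K=K(n)\ge 0$ be integers with $m=o(\sqrt n)$ and $K=O(\sqrt n)$ as $n\to\infty$. Let $G\sim\mathrm{ER}(n,n,p)$ be the random bipartite graph with parts $V,V'$, $|V|=|V'|=n$, in which every pair $(u,v)\in V\times V'$ is an edge independently with probability $p$. Let $\mathcal A_0\subseteq V$, $\mathcal B_0\subseteq V'$ have $|\mathcal A_0|=|\mathcal B_0|=K$, and let $G'$ be obtained from $G$ by adding all edges of $\mathcal A_0\times\mathcal B_0$; let $\xi_{uv}\in\{0,1\}$ be the indicator that $(u,v)$ is an edge of $G'$. Here $\mathcal A_0,\mathcal B_0$ are either arbitrary fixed sets, or chosen independently and uniformly at random and independently of $G$. For $i\in V$ define the weight $$W(i)=\frac{1}{\binom{n-1}{m-1}\binom nm}\sum_{\substack{\mathcal A\subseteq V,\ |\mathcal A|=m\\ i\in\mathcal A}}\ \sum_{\substack{\mathcal B\subseteq V'\\ |\mathcal B|=m}} Y(\mathcal A,\mathcal B)^2,\qquad Y(\mathcal A,\mathcal B)=\frac1{p^m m!}\sum_{\sigma\in\mathrm{Bij}(\mathcal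 A,\mathcal B)}\ \prod_{u\in\mathcal A}\xi_{u\sigma(u)},$$ and define $W(i)$ for $i\in V'$ analogously, exchanging the roles of $V$ and $V'$. Then there are constants $0<c\le C<\infty$, which may depend on $p$ and on the sequences $m(\cdot),K(\cdot)$ but not on $n$, $\mathcal A_0$, $\mathcal B_0$ or on the vertices, such that for all sufficiently large $n$: 1. for every vertex $i$, $\ c\,\frac1n(\mathbb E\,W(i))^2\le \mathrm{Var}(W(i))\le C\,\frac1n(\mathbb E\,W(i))^2$; 2. if $m(n)\ge 2$, then for all $i\ne j$ on the same side of the graph, $\ c\,\frac{m^2}{n^2}(\mathbb E\,W(i))^2\le \mathrm{Cov}(W(i),W(j))\le C\,\frac{m^2}{n^2}(\mathbb E\,W(i))^2$; 3. for every vertex $i$, $\ c\,\frac{\mathbb E\,W(i)}{\sqrt n}\le \sqrt{\mathrm{Var}(W(i))}\le C\,\frac{\mathbb E\,W(i)}{\sqrt n}$. -/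

import Mathlib

open MeasureTheory ProbabilityTheory Filter Asymptotics
open scoped ENNReal

noncomputable section

/-- A bipartite graph with parts `V = Fin n` and `V' = Fin n`:
`G u v = true` means that the edge between `u ∈ V` and `v ∈ V'` is present. -/
abbrev BipGraph (n : ℕ) : Type := Fin n → Fin n → Bool

/-- The edge indicator `ξ_{uv}`. -/
def edgeInd {n : ℕ} (G : BipGraph n) (u v : Fin n) : ℝ := if G u v = true then 1 else 0

/-- The graph with the roles of `V` and `V'` exchanged. -/
def swapSides {n : ℕ} (G : BipGraph n) : BipGraph n := fun v u => G u v

/-- The law `ER(n, n, p)`: every edge is present independently with probability `p`. -/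
def erLaw (n : ℕ) (p : unitInterval) : Measure (BipGraph n) :=
  Measure.pi fun _ : Fin n => Measure.pi fun _ : Fin n => bernoulliMeasure true false p

/-- The graph `G` after all edges of `A₀ × B₀` have been made present. -/
def plantBiclique {n : ℕ} (A₀ B₀ : Finset (Fin n)) (G : BipGraph n) : BipGraph n :=
  fun u v => if u ∈ A₀ ∧ v ∈ B₀ then true else G u v

/-- The law of the graph `G'` given the planted sets `A₀ ⊆ V` and `B₀ ⊆ V'`. -/
def plantedLaw (n : ℕ) (p : unitInterval) (A₀ B₀ : Finset (Fin n)) : Measure (BipGraph n) :=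
  (erLaw n p).map (plantBiclique A₀ B₀)

/-- The law `ER(n, n, p, K, K)`: the planted sets `A₀`, `B₀` are chosen uniformly at random,
independently of each other and of the Erdős–Rényi graph, among the `K`-subsets of `V`
and of `V'`. -/
def randomPlantedLaw (n : ℕ) (p : unitInterval) (K : ℕ) : Measure (BipGraph n) :=
  ∑ A₀ ∈ (Finset.univ : Finset (Fin n)).powersetCard K,
    ∑ B₀ ∈ (Finset.univ : Finset (Fin n)).powersetCard K,
      ((n.choose K : ℝ≥0∞)⁻¹ * (n.choose K : ℝ≥0∞)⁻¹) • plantedLaw n p A₀ B₀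

/-- `Y(A, B) = (p^m m!)⁻¹ ∑_{σ ∈ Bij(A, B)} ∏_{u ∈ A} ξ_{u σ(u)}`, for `|A| = |B| = m`. -/
def matchingStat {n : ℕ} (p : ℝ) (m : ℕ) (G : BipGraph n) (A B : Finset (Fin n)) : ℝ :=
  (∑ σ : (A ≃ B), ∏ u : A, edgeInd G u (σ u)) / (p ^ m * (m.factorial : ℝ))

/-- The weight `W(i)` of a vertex `i ∈ V`. -/
def leftWeight {n : ℕ} (p : ℝ) (m : ℕ) (G : BipGraph n) (i : Fin n) : ℝ :=
  (∑ A ∈ (Finset.univ : Finset (Fin n)).powersetCard m with i ∈ A,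
    ∑ B ∈ (Finset.univ : Finset (Fin n)).powersetCard m, matchingStat p m G A B ^ 2) /
      (((n - 1).choose (m - 1) : ℝ) * (n.choose m : ℝ))

/-- The weight of a vertex `i ∈ V'`, defined analogously. -/
def rightWeight {n : ℕ} (p : ℝ) (m : ℕ) (G : BipGraph n) (i : Fin n) : ℝ :=
  leftWeight p m (swapSides G) i

end

open scoped BigOperators

/-! Put `L = 1/p` and `P = A₀ × B₀`. Expanding the square, `W(i)` is the average of `1{c ⊆ G'} /
p^(2m)` over pairs `c` of perfect matchings between a common `m`-set through `i` and a common
`m`-set on the other side (`leftWeight_eq_expect`). For given planted sets its mean is the average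
of `p^(|c \ P| - 2m)`, and a covariance is the average over `c, d` of `p^(u - 4m) (1 - p^r)`, where
`u = |(c ∪ d) \ P|` and `r` counts the edges outside `P` that `c` and `d` share
(`covariance_leftWeight_plantedLaw`). All these terms are nonnegative, and only pairs with a shared
edge contribute.

Since `|c \ P| ≤ 2m`, the mean is at least 1. The deficit `2m - |c \ P|` is at most the number of
fixed points of a random permutation plus the number of matching edges ending in `B₀`. As `mK =
O(n)`, both have bounded exponential moments, so the mean is of order 1. The same moment bounds,
with one shared edge pinned, show that the factor `L^excess` costs only a constant. Hence the
covariance has the order of the expected number of shared edges (`covariance_plantedLaw_le`,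
`le_covariance_plantedLaw`). A left vertex common to both pairs gets the same right partner with
probability `1/n`, so this order is `meanCommon m i j / n`. The quantity `meanCommon` lies between 1
and 2 for `i = j` and has order `m²/n` for `i ≠ j`, `m ≥ 2`.

For random planted sets the law of total covariance adds the covariance of the conditional means. By
symmetry these are `a + b 1{i ∈ A}`, and `b = O(K/n)` because deleting one planted vertex changes
the mean by that much (`exists_mean_eq`). The added term is `O(K³/n³) meanCommon`, which is
negligible because `K³ = O(n^(3/2)) = o(n²)`. Vertices of `V'` are handled by exchanging the sides,
and the third claim is the square root of the first. -/

/-! ### Exponential moments of uniform random injections and permutations. -/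

/-- The restriction of a uniform injection to `T` is a uniform injection of `T`. Enlarging the sum
over injections of `T` to all functions makes it factorise, so sampling without replacement costs
only the falling factorial in place of a power. -/
theorem expect_embedding_prod_le {α β : Type*} [Fintype α] [DecidableEq α] [Fintype β]
    [DecidableEq β] (hcard : Fintype.card α ≤ Fintype.card β) (T : Finset α) (h : α → β → ℝ)
    (h0 : ∀ w v, 0 ≤ h w v) :
    𝔼 s : α ↪ β, ∏ w ∈ T, h w (s w) ≤
      (∏ w ∈ T, ∑ v, h w v) / ((Fintype.card β).descFactorial T.card : ℝ) := by
  classical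
  have hT : T.card ≤ Fintype.card α := T.card_le_univ
  -- An injection is its restriction to `T` together with an injection of the rest into the unused
  -- values; the number of the latter does not depend on the restriction.
  let e : (α ↪ β) ≃ (Σ t : {x // x ∈ T} ↪ β, {x // ¬ x ∈ T} ↪ ↥(Set.range t)ᶜ) :=
    ((Equiv.sumCompl (· ∈ T)).symm.embeddingCongr (Equiv.refl β)).trans
      Equiv.sumEmbeddingEquivSigmaEmbeddingRestricted
  have he : ∀ s : α ↪ β, ∏ w ∈ T, h w (s w) = ∏ w : {x // x ∈ T}, h w ((e s).1 w) := by
    intro s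
    rw [← Finset.prod_coe_sort]
    exact Finset.prod_congr rfl fun w _ => rfl
  have hsum : ∑ s : α ↪ β, ∏ w ∈ T, h w (s w) =
      ∑ t : {x // x ∈ T} ↪ β, ((Fintype.card β - T.card).descFactorial
        (Fintype.card α - T.card) : ℝ) * ∏ w : {x // x ∈ T}, h w (t w) := by
    calc ∑ s : α ↪ β, ∏ w ∈ T, h w (s w)
        = ∑ s : α ↪ β, ∏ w : {x // x ∈ T}, h w ((e s).1 w) :=
          Finset.sum_congr rfl fun s _ => he s
      _ = ∑ x : (Σ t : {x // x ∈ T} ↪ β, {x // ¬ x ∈ T} ↪ ↥(Set.range t)ᶜ),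
            ∏ w : {x // x ∈ T}, h w (x.1 w) :=
          Equiv.sum_comp e fun x => ∏ w : {x // x ∈ T}, h w (x.1 w)
      _ = _ := by
          rw [Fintype.sum_sigma]
          refine Finset.sum_congr rfl fun t _ => ?_
          simp only [Finset.sum_const, nsmul_eq_mul, Finset.card_univ]
          congr 2
          rw [Fintype.card_embedding_eq, Fintype.card_compl_set, Fintype.card_range,
            Fintype.card_subtype_compl]
          simp
  have hbound : ∑ t : {x // x ∈ T} ↪ β, ∏ w : {x // x ∈ T}, h w (t w) ≤
      ∏ w ∈ T, ∑ v, h w v := by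
    rw [← Finset.prod_coe_sort T, Fintype.prod_sum fun (w : {x // x ∈ T}) v => h w v]
    calc ∑ t : {x // x ∈ T} ↪ β, ∏ w : {x // x ∈ T}, h w (t w)
        = ∑ t ∈ Finset.univ.map ⟨fun t : {x // x ∈ T} ↪ β => (t : {x // x ∈ T} → β),
            DFunLike.coe_injective⟩, ∏ w : {x // x ∈ T}, h w (t w) := by
          rw [Finset.sum_map]; rfl
      _ ≤ _ := Finset.sum_le_sum_of_subset_of_nonneg (Finset.subset_univ _)
          fun t _ _ => Finset.prod_nonneg fun w _ => h0 _ _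
  have hN : (Fintype.card (α ↪ β) : ℝ) = ((Fintype.card β - T.card).descFactorial
        (Fintype.card α - T.card) : ℝ) * ((Fintype.card β).descFactorial T.card : ℝ) := by
    rw [Fintype.card_embedding_eq, ← Nat.descFactorial_mul_descFactorial hT]
    push_cast; rfl
  have h1 : (0 : ℝ) < ((Fintype.card β - T.card).descFactorial (Fintype.card α - T.card) : ℝ) := by
    exact_mod_cast Nat.descFactorial_pos.mpr (by omega)
  have h2 : (0 : ℝ) < ((Fintype.card β).descFactorial T.card : ℝ) := by
    exact_mod_cast Nat.descFactorial_pos.mpr (by omega)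
  rw [Fintype.expect_eq_sum_div_card, hsum, hN, ← Finset.mul_sum, mul_div_mul_left _ _ h1.ne']
  gcongr

/-- Factor by factor, `(m - k)/(N - k) ≤ m/N`. This trades falling factorials for powers and leads
to an exponential series with argument `H m / N`. -/
theorem descFactorial_mul_pow_le {m N : ℕ} (h : m ≤ N) (k : ℕ) :
    m.descFactorial k * N ^ k ≤ m ^ k * N.descFactorial k := by
  induction k with
  | zero => simp
  | succ k ih =>
    rw [Nat.descFactorial_succ, Nat.descFactorial_succ, pow_succ, pow_succ]
    have h1 : (m - k) * N ≤ m * (N - k) := by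
      rcases le_total m k with hk | hk
      · simp [Nat.sub_eq_zero_of_le hk]
      · zify [hk, hk.trans h]
        have : (m : ℤ) * k ≤ N * k := by gcongr
        nlinarith
    calc (m - k) * m.descFactorial k * (N ^ k * N)
        = (m.descFactorial k * N ^ k) * ((m - k) * N) := by ring
      _ ≤ (m ^ k * N.descFactorial k) * (m * (N - k)) := Nat.mul_le_mul ih h1
      _ = _ := by ring

theorem choose_mul_pow_div_descFactorial_le {m N : ℕ} (h : m ≤ N) {k : ℕ} (hk : k ≤ m) {H : ℝ}
    (hH : 0 ≤ H) :
    (m.choose k : ℝ) * (H ^ k / (N.descFactorial k : ℝ)) ≤ (H * m / N) ^ k / (k.factorial : ℝ) := by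
  rcases Nat.eq_zero_or_pos N with rfl | hN
  · obtain rfl : k = 0 := by omega
    simp
  have h2 : (0 : ℝ) < (N.descFactorial k : ℝ) := by
    exact_mod_cast Nat.descFactorial_pos.mpr (hk.trans h)
  have h3 : (0 : ℝ) < (k.factorial : ℝ) := by positivity
  have hN' : (0 : ℝ) < (N : ℝ) := by exact_mod_cast hN
  have h4 : (m.choose k : ℝ) * k.factorial = m.descFactorial k := by
    rw [Nat.descFactorial_eq_factorial_mul_choose]; push_cast; ring
  have h5 : (m.descFactorial k : ℝ) * N ^ k ≤ m ^ k * N.descFactorial k := by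
    exact_mod_cast descFactorial_mul_pow_le h k
  rw [div_pow, mul_pow, ← mul_div_assoc, div_div, div_le_div_iff₀ h2 (by positivity)]
  calc (m.choose k : ℝ) * H ^ k * (N ^ k * k.factorial)
      = H ^ k * (m.descFactorial k * N ^ k) := by rw [← h4]; ring
    _ ≤ H ^ k * (m ^ k * N.descFactorial k) := by gcongr
    _ = _ := by ring

theorem sum_powerset_pow_div_descFactorial_le {α : Type*} [DecidableEq α] (S : Finset α) {N : ℕ}
    (h : S.card ≤ N) {H : ℝ} (hH : 0 ≤ H) :
    ∑ T ∈ S.powerset, H ^ T.card / (N.descFactorial T.card : ℝ) ≤ Real.exp (H * S.card / N) := by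
  rw [Finset.sum_powerset_apply_card (fun k => H ^ k / (N.descFactorial k : ℝ))]
  refine le_trans (Finset.sum_le_sum fun k hk => ?_)
    (Real.sum_le_exp_of_nonneg (by positivity) (S.card + 1))
  rw [nsmul_eq_mul]
  exact choose_mul_pow_div_descFactorial_le h (by simpa [Nat.lt_succ_iff] using hk) hH

theorem expect_embedding_prod_one_add_le {α β : Type*} [Fintype α] [DecidableEq α] [Fintype β]
    [DecidableEq β] (hcard : Fintype.card α ≤ Fintype.card β) (h : α → β → ℝ)
    (h0 : ∀ w v, 0 ≤ h w v) {H : ℝ} (hH : ∀ w, ∑ v, h w v ≤ H) (hH0 : 0 ≤ H) :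
    𝔼 s : α ↪ β, ∏ w, (1 + h w (s w)) ≤ Real.exp (H * Fintype.card α / Fintype.card β) := by
  calc 𝔼 s : α ↪ β, ∏ w, (1 + h w (s w))
      = ∑ T ∈ (Finset.univ : Finset α).powerset, 𝔼 s : α ↪ β, ∏ w ∈ T, h w (s w) := by
        simp_rw [Finset.prod_one_add]
        rw [Finset.expect_sum_comm]
    _ ≤ ∑ T ∈ (Finset.univ : Finset α).powerset,
          H ^ T.card / ((Fintype.card β).descFactorial T.card : ℝ) := by
        refine Finset.sum_le_sum fun T _ => (expect_embedding_prod_le hcard T h h0).trans ?_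
        gcongr
        rw [← Finset.prod_const]
        exact Finset.prod_le_prod (fun w _ => Finset.sum_nonneg fun v _ => h0 w v) fun w _ => hH w
    _ ≤ _ := sum_powerset_pow_div_descFactorial_le _ hcard hH0

/-- The version with one value pinned: the event `s l = v₀` costs a factor `1/N`, the factor of the
product at `l` is at most `M`, and the other indices behave as in the unpinned bound. The pin enters
the product formula as a row `l` equal to the indicator of `v₀`. -/
theorem expect_embedding_ite_mul_prod_one_add_le {α β : Type*} [Fintype α] [DecidableEq α]
    [Fintype β] [DecidableEq β] (hcard : Fintype.card α ≤ Fintype.card β) (h : α → β → ℝ)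
    (h0 : ∀ w v, 0 ≤ h w v) {H M : ℝ} (hH : ∀ w, ∑ v, h w v ≤ H) (hH0 : 0 ≤ H) (l : α) (v₀ : β)
    (hM : 1 + h l v₀ ≤ M) :
    𝔼 s : α ↪ β, (if s l = v₀ then 1 else 0) * ∏ w, (1 + h w (s w)) ≤
      M / Fintype.card β * Real.exp (H * Fintype.card α / Fintype.card β) := by
  have hα : 0 < Fintype.card α := Fintype.card_pos_iff.mpr ⟨l⟩
  have hβ : 0 < Fintype.card β := hα.trans_le hcard
  have hM0 : 0 ≤ M := le_trans (by have := h0 l v₀; linarith) hM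
  let S : Finset α := Finset.univ.erase l
  have hS : S.card = Fintype.card α - 1 := by simp [S, Finset.card_univ]
  let g : α → β → ℝ := fun w v => if w = l then (if v = v₀ then 1 else 0) else h w v
  have g0 : ∀ w v, 0 ≤ g w v := by
    intro w v; simp only [g]; split_ifs <;> first | positivity | exact h0 w v
  have hlT : ∀ T ∈ S.powerset, l ∉ T := fun T hT hl => by
    simpa [S] using Finset.mem_powerset.mp hT hl
  have hgT : ∀ T ∈ S.powerset, ∀ s : α ↪ β, (if s l = v₀ then (1 : ℝ) else 0) *
      ∏ w ∈ T, h w (s w) = ∏ w ∈ insert l T, g w (s w) := by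
    intro T hT s
    rw [Finset.prod_insert (hlT T hT)]
    congr 1
    · simp [g]
    · refine Finset.prod_congr rfl fun w hw => ?_
      have : w ≠ l := fun h' => hlT T hT (h' ▸ hw)
      simp [g, this]
  calc 𝔼 s : α ↪ β, (if s l = v₀ then 1 else 0) * ∏ w, (1 + h w (s w))
      ≤ 𝔼 s : α ↪ β, M * ((if s l = v₀ then 1 else 0) * ∏ w ∈ S, (1 + h w (s w))) := by
        refine Finset.expect_le_expect fun s _ => ?_
        rw [← Finset.mul_prod_erase Finset.univ _ (Finset.mem_univ l)]
        have hp : 0 ≤ ∏ w ∈ S, (1 + h w (s w)) :=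
          Finset.prod_nonneg fun w _ => by have := h0 w (s w); linarith
        split_ifs with hs
        · rw [hs, one_mul, one_mul]
          exact mul_le_mul_of_nonneg_right hM hp
        · simp
    _ = M * ∑ T ∈ S.powerset, 𝔼 s : α ↪ β, ∏ w ∈ insert l T, g w (s w) := by
        rw [← Finset.mul_expect, ← Finset.expect_sum_comm]
        congr 1
        refine Finset.expect_congr rfl fun s _ => ?_
        rw [Finset.prod_one_add, Finset.mul_sum]
        exact Finset.sum_congr rfl fun T hT => hgT T hT s
    _ ≤ M * ∑ T ∈ S.powerset, (1 / Fintype.card β) *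
          (H ^ T.card / ((Fintype.card β - 1).descFactorial T.card : ℝ)) := by
        gcongr with T hT
        refine (expect_embedding_prod_le hcard _ g g0).trans ?_
        rw [Finset.card_insert_of_notMem (hlT T hT), Finset.prod_insert (hlT T hT)]
        have e1 : ∑ v, g l v = 1 := by simp [g]
        have e2 : ∏ w ∈ T, ∑ v, g w v ≤ H ^ T.card := by
          rw [← Finset.prod_const]
          refine Finset.prod_le_prod (fun w _ => Finset.sum_nonneg fun v _ => g0 w v) fun w hw => ?_
          have : w ≠ l := fun h' => hlT T hT (h' ▸ hw)
          simpa [g, this] using hH w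
        have e3 : (Fintype.card β).descFactorial (T.card + 1) =
            Fintype.card β * (Fintype.card β - 1).descFactorial T.card := by
          obtain ⟨b, hb⟩ : ∃ b, Fintype.card β = b + 1 := ⟨_, (Nat.succ_pred_eq_of_pos hβ).symm⟩
          rw [hb, Nat.succ_descFactorial_succ]; simp
        rw [e1, one_mul, e3, div_mul_div_comm, one_mul]
        push_cast
        gcongr
    _ ≤ M * ((1 / Fintype.card β) * Real.exp (H * S.card / (Fintype.card β - 1 : ℕ))) := by
        rw [← Finset.mul_sum]
        gcongr
        exact sum_powerset_pow_div_descFactorial_le _ (by omega) hH0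
    _ ≤ _ := by
        rw [← mul_assoc, mul_one_div]
        gcongr ?_ * ?_
        rw [Real.exp_le_exp, mul_div_assoc, mul_div_assoc, hS]
        refine mul_le_mul_of_nonneg_left ?_ hH0
        -- For a target with one element the left quotient is a division by zero, hence 0; otherwise
        -- `(a - 1)/(N - 1) ≤ a/N` because `a ≤ N`.
        rcases Nat.eq_zero_or_pos (Fintype.card β - 1) with h0' | h0'
        · rw [h0']; simp; positivity
        rw [div_le_div_iff₀ (by exact_mod_cast h0') (by exact_mod_cast hβ)]
        have : (1 : ℝ) ≤ Fintype.card α := by exact_mod_cast hα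
        have h5 : (Fintype.card α : ℝ) ≤ Fintype.card β := by exact_mod_cast hcard
        rw [Nat.cast_sub hα, Nat.cast_sub hβ]
        push_cast
        nlinarith

/-- Linearises `L^r` for bounded integer exponents, which brings `L^(∑ R)` into the form `∏ (1 +
h)`. Below, `d` bounds one exponent and `D` the sum of exponents over a row. -/
theorem pow_le_one_add_mul {L : ℝ} (hL : 1 ≤ L) {r d : ℕ} (h : r ≤ d) :
    L ^ r ≤ 1 + (L ^ d - 1) * r := by
  have hd : 1 ≤ L ^ d := one_le_pow₀ hL
  rcases Nat.eq_zero_or_pos r with rfl | hr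
  · simp
  · have h1 : L ^ r ≤ L ^ d := pow_le_pow_right₀ hL h
    have h2 : (1 : ℝ) ≤ r := by exact_mod_cast hr
    nlinarith

theorem expect_embedding_pow_sum_le {α β : Type*} [Fintype α] [DecidableEq α] [Fintype β]
    [DecidableEq β] (hcard : Fintype.card α ≤ Fintype.card β) {L : ℝ} (hL : 1 ≤ L) (R : α → β → ℕ)
    {d D : ℕ} (hd : ∀ w v, R w v ≤ d) (hD : ∀ w, ∑ v, R w v ≤ D) :
    𝔼 s : α ↪ β, L ^ ∑ w, R w (s w) ≤
      Real.exp ((L ^ d - 1) * D * Fintype.card α / Fintype.card β) := by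
  have hx : 0 ≤ L ^ d - 1 := by have := one_le_pow₀ hL (n := d); linarith
  refine le_trans (Finset.expect_le_expect fun s _ => ?_)
    (expect_embedding_prod_one_add_le hcard (fun w v => (L ^ d - 1) * R w v)
      (fun w v => by positivity) (H := (L ^ d - 1) * D) (fun w => ?_) (by positivity))
  · rw [← Finset.prod_pow_eq_pow_sum]
    exact Finset.prod_le_prod (fun w _ => by positivity) fun w _ => pow_le_one_add_mul hL (hd _ _)
  · rw [← Finset.mul_sum]
    gcongr
    exact_mod_cast hD w

theorem expect_embedding_ite_mul_pow_sum_le {α β : Type*} [Fintype α] [DecidableEq α] [Fintype β]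
    [DecidableEq β] (hcard : Fintype.card α ≤ Fintype.card β) {L : ℝ} (hL : 1 ≤ L) (R : α → β → ℕ)
    {d D : ℕ} (hd : ∀ w v, R w v ≤ d) (hD : ∀ w, ∑ v, R w v ≤ D) (l : α) (v₀ : β) :
    𝔼 s : α ↪ β, (if s l = v₀ then 1 else 0) * L ^ ∑ w, R w (s w) ≤
      (1 + (L ^ d - 1) * d) / Fintype.card β *
        Real.exp ((L ^ d - 1) * D * Fintype.card α / Fintype.card β) := by
  have hx : 0 ≤ L ^ d - 1 := by have := one_le_pow₀ hL (n := d); linarith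
  refine le_trans (Finset.expect_le_expect fun s _ => ?_)
    (expect_embedding_ite_mul_prod_one_add_le hcard (fun w v => (L ^ d - 1) * R w v)
      (fun w v => by positivity) (H := (L ^ d - 1) * D) (fun w => ?_) (by positivity) l v₀ ?_)
  · rw [← Finset.prod_pow_eq_pow_sum]
    gcongr with w
    exact pow_le_one_add_mul hL (hd _ _)
  · rw [← Finset.mul_sum]
    gcongr
    exact_mod_cast hD w
  · gcongr
    exact hd l v₀

/-- Permutations are the case of equal cardinalities, where the bound no longer depends on the size.
-/
theorem expect_perm_pow_sum_le {α : Type*} [Fintype α] [DecidableEq α] {L : ℝ} (hL : 1 ≤ L)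
    (R : α → α → ℕ) {d D : ℕ} (hd : ∀ w v, R w v ≤ d) (hD : ∀ w, ∑ v, R w v ≤ D) :
    𝔼 π : Equiv.Perm α, L ^ ∑ w, R w (π w) ≤ Real.exp ((L ^ d - 1) * D) := by
  have hx : 0 ≤ L ^ d - 1 := by have := one_le_pow₀ hL (n := d); linarith
  calc 𝔼 π : Equiv.Perm α, L ^ ∑ w, R w (π w) = 𝔼 s : α ↪ α, L ^ ∑ w, R w (s w) :=
        Fintype.expect_equiv (Equiv.embeddingEquivOfFinite α).symm _ _ fun π => rfl
    _ ≤ _ := expect_embedding_pow_sum_le le_rfl hL R hd hD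
    _ ≤ _ := by
        rw [Real.exp_le_exp, mul_div_assoc]
        exact mul_le_of_le_one_right (by positivity) (div_self_le_one _)

/-! ### The weight as an average over pairs of matchings. -/

/-- The product of the indicators of the edges in `S`. -/
def edgesPresent {n : ℕ} (G : BipGraph n) (S : Finset (Fin n × Fin n)) : ℝ :=
  ∏ e ∈ S, edgeInd G e.1 e.2

/-- The edges joining `f k` to `a k`. -/
def pairEdges {m n : ℕ} (f a : Fin m → Fin n) : Finset (Fin n × Fin n) :=
  Finset.univ.image fun k => (f k, a k)

/-- Two `m`-sets with enumerations `f`, `g`, and the two matchings `f k ↦ g k` and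
`f k ↦ g (π k)` between them. -/
abbrev MatchingPair (m n : ℕ) : Type := (Fin m ↪ Fin n) × (Fin m ↪ Fin n) × Equiv.Perm (Fin m)

/-- The union of the two matchings. -/
def MatchingPair.edges {m n : ℕ} (c : MatchingPair m n) : Finset (Fin n × Fin n) :=
  pairEdges c.1 c.2.1 ∪ pairEdges c.1 (c.2.1 ∘ c.2.2)

/-- The injections `Fin m → Fin n` whose range contains `i`. -/
noncomputable def embeddingsThrough (m : ℕ) {n : ℕ} (i : Fin n) : Finset (Fin m ↪ Fin n) :=
  Finset.univ.filter fun f => i ∈ Finset.univ.map f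

/-- The pairs of matchings covering the left vertex `i`. -/
noncomputable def pairsThrough (m : ℕ) {n : ℕ} (i : Fin n) : Finset (MatchingPair m n) :=
  embeddingsThrough m i ×ˢ (Finset.univ ×ˢ Finset.univ)

theorem edgesPresent_mul {n : ℕ} (G : BipGraph n) (S T : Finset (Fin n × Fin n)) :
    edgesPresent G S * edgesPresent G T = edgesPresent G (S ∪ T) := by
  have key : ∀ U : Finset (Fin n × Fin n), edgesPresent G U =
      if ∀ e ∈ U, G e.1 e.2 = true then 1 else 0 := by
    intro U
    simp only [edgesPresent, edgeInd]
    rw [Finset.prod_ite_zero]; simp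
  simp only [key, ← ite_and, mul_ite, mul_one, mul_zero]
  congr 1
  simp only [Finset.mem_union, eq_iff_iff]
  constructor
  · rintro ⟨h1, h2⟩ e (he | he)
    exacts [h2 e he, h1 e he]
  · intro h
    exact ⟨fun e he => h e (Or.inr he), fun e he => h e (Or.inl he)⟩

theorem edgesPresent_pairEdges {m n : ℕ} (G : BipGraph n) (f : Fin m ↪ Fin n) (a : Fin m → Fin n) :
    edgesPresent G (pairEdges f a) = ∏ k, edgeInd G (f k) (a k) := by
  rw [edgesPresent, pairEdges, Finset.prod_image]
  intro k _ l _ h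
  exact f.injective (Prod.ext_iff.mp h).1

theorem sum_embedding_map_eq {m n : ℕ} (B : Finset (Fin n)) (Φ : (Fin m → Fin n) → ℝ) :
    ∑ g : Fin m ↪ Fin n with Finset.univ.map g = B, Φ g =
      ∑ σ : Fin m ≃ B, Φ (fun k => (σ k : Fin n)) := by
  symm
  refine Finset.sum_bij (fun σ _ => σ.toEmbedding.trans (Function.Embedding.subtype _))
    ?_ ?_ ?_ ?_
  · intro σ _
    rw [Finset.mem_filter]
    refine ⟨Finset.mem_univ _, ?_⟩
    ext v
    simp only [Finset.mem_map, Finset.mem_univ, true_and]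
    constructor
    · rintro ⟨k, rfl⟩; exact (σ k).2
    · intro hv; exact ⟨σ.symm ⟨v, hv⟩, by simp⟩
  · intro σ _ τ _ h
    ext k
    exact congrArg Fin.val (DFunLike.congr_fun h k)
  · intro g hg
    rw [Finset.mem_filter] at hg
    have hmem : ∀ k, g k ∈ B := fun k => by
      rw [← hg.2]; exact Finset.mem_map_of_mem g (Finset.mem_univ k)
    refine ⟨Equiv.ofBijective (fun k => ⟨g k, hmem k⟩) ⟨fun k l h => g.injective ?_, ?_⟩,
      Finset.mem_univ _, ?_⟩
    · simpa using h
    · rintro ⟨v, hv⟩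
      rw [← hg.2] at hv
      obtain ⟨k, -, rfl⟩ := Finset.mem_map.mp hv
      exact ⟨k, rfl⟩
    · ext k; rfl
  · intro σ _; rfl

theorem sum_perm_comp_eq {m n : ℕ} (g : Fin m ↪ Fin n) (Φ : (Fin m → Fin n) → ℝ) :
    ∑ π : Equiv.Perm (Fin m), Φ (g ∘ π) =
      ∑ h : Fin m ↪ Fin n with Finset.univ.map h = Finset.univ.map g, Φ h := by
  rw [sum_embedding_map_eq]
  let e : Fin m ≃ (Finset.univ.map g : Finset (Fin n)) :=
    Equiv.ofBijective (fun k => ⟨g k, Finset.mem_map_of_mem g (Finset.mem_univ k)⟩)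
      ⟨fun k l h => g.injective (by simpa using h), by
        rintro ⟨v, hv⟩
        obtain ⟨k, -, rfl⟩ := Finset.mem_map.mp hv
        exact ⟨k, rfl⟩⟩
  exact Fintype.sum_equiv ((Equiv.refl (Fin m)).equivCongr e) _ _ fun π => rfl

theorem sum_bijections_eq {m n : ℕ} (G : BipGraph n) (f : Fin m ↪ Fin n) (B : Finset (Fin n)) :
    ∑ σ : ((Finset.univ.map f : Finset (Fin n)) ≃ B),
        ∏ u : (Finset.univ.map f : Finset (Fin n)), edgeInd G u (σ u) =
      ∑ g : Fin m ↪ Fin n with Finset.univ.map g = B, ∏ k, edgeInd G (f k) (g k) := by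
  rw [sum_embedding_map_eq B fun g => ∏ k, edgeInd G (f k) (g k)]
  let e : Fin m ≃ (Finset.univ.map f : Finset (Fin n)) :=
    Equiv.ofBijective (fun k => ⟨f k, Finset.mem_map_of_mem f (Finset.mem_univ k)⟩)
      ⟨fun k l h => f.injective (by simpa using h), by
        rintro ⟨v, hv⟩
        obtain ⟨k, -, rfl⟩ := Finset.mem_map.mp hv
        exact ⟨k, rfl⟩⟩
  refine Fintype.sum_equiv (e.symm.equivCongr (Equiv.refl B)) _ _ fun σ => ?_
  rw [← Equiv.prod_comp e]
  rfl

theorem sum_embedding_eq_factorial_mul {m n : ℕ} (i : Fin n) (H : Finset (Fin n) → ℝ) :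
    ∑ f ∈ embeddingsThrough m i, H (Finset.univ.map f) =
      (m.factorial : ℝ) * ∑ A ∈ (Finset.univ : Finset (Fin n)).powersetCard m with i ∈ A, H A := by
  rw [← Finset.sum_fiberwise_of_maps_to (s := embeddingsThrough m i)
    (t := (Finset.univ : Finset (Fin n)).powersetCard m |>.filter (i ∈ ·))
    (g := fun f => Finset.univ.map f), Finset.mul_sum]
  · refine Finset.sum_congr rfl fun A hA => ?_
    rw [Finset.mem_filter, Finset.mem_powersetCard] at hA
    have h1 : (embeddingsThrough m i).filter (fun f => Finset.univ.map f = A) =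
        Finset.univ.filter fun f : Fin m ↪ Fin n => Finset.univ.map f = A := by
      ext f
      simp only [embeddingsThrough, Finset.mem_filter, Finset.mem_univ, true_and,
        and_iff_right_iff_imp]
      rintro rfl; exact hA.2
    rw [h1, Finset.sum_congr rfl (g := fun _ => H A)
      (by intro f hf; rw [(Finset.mem_filter.mp hf).2]),
      sum_embedding_map_eq A fun _ => H A, Finset.sum_const, Finset.card_univ, nsmul_eq_mul]
    congr 2
    have e : Fin m ≃ A := Fintype.equivOfCardEq (by simp [hA.1.2])
    rw [Fintype.card_equiv e, Fintype.card_fin]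
  · intro f hf
    simp only [embeddingsThrough, Finset.mem_filter, Finset.mem_univ, true_and] at hf
    simpa [Finset.mem_filter, Finset.mem_powersetCard] using hf

theorem sum_embedding_univ_fiberwise {m n : ℕ} (H : (Fin m ↪ Fin n) → ℝ) :
    ∑ g : Fin m ↪ Fin n, H g = ∑ B ∈ (Finset.univ : Finset (Fin n)).powersetCard m,
      ∑ g : Fin m ↪ Fin n with Finset.univ.map g = B, H g := by
  rw [Finset.sum_fiberwise_of_maps_to]
  intro g _
  simp [Finset.mem_powersetCard]

theorem card_embeddingsThrough {m n : ℕ} (hm : 1 ≤ m) (i : Fin n) :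
    ((embeddingsThrough m i).card : ℝ) = m.factorial * (n - 1).choose (m - 1) := by
  have h := sum_embedding_eq_factorial_mul (m := m) i fun _ => 1
  have h2 := Finset.card_filter_powersetCard_subset {i} (Finset.univ : Finset (Fin n)) m
    (by simp) (by simpa using hm)
  simp only [Finset.singleton_subset_iff, Finset.card_singleton, Finset.card_univ,
    Fintype.card_fin] at h2
  simp only [Finset.sum_const, nsmul_eq_mul, mul_one, h2] at h
  exact h

/-- The square of a sum over bijections is a sum over ordered pairs of bijections. With `A`
enumerated by `f`, these correspond one to one to `(g, π)` with `g` enumerating `B`, and each `A`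
has `m!` enumerations. The remaining factors match the normalisation of `W`. -/
theorem leftWeight_eq_expect {m n : ℕ} (hm : 1 ≤ m) (p : ℝ) (G : BipGraph n) (i : Fin n) :
    leftWeight p m G i = 𝔼 c ∈ pairsThrough m i, edgesPresent G c.edges / p ^ (2 * m) := by
  have hfac : (m.factorial : ℝ) ≠ 0 := by positivity
  have hsum : ∑ c ∈ pairsThrough m i, edgesPresent G c.edges =
      m.factorial * ∑ A ∈ (Finset.univ : Finset (Fin n)).powersetCard m with i ∈ A,
        ∑ B ∈ (Finset.univ : Finset (Fin n)).powersetCard m,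
          (∑ σ : (A ≃ B), ∏ u : A, edgeInd G u (σ u)) ^ 2 := by
    rw [← sum_embedding_eq_factorial_mul (m := m) i fun A =>
        ∑ B ∈ (Finset.univ : Finset (Fin n)).powersetCard m,
          (∑ σ : (A ≃ B), ∏ u : A, edgeInd G u (σ u)) ^ 2,
      pairsThrough, Finset.sum_product]
    refine Finset.sum_congr rfl fun f _ => ?_
    rw [Finset.sum_product, sum_embedding_univ_fiberwise]
    refine Finset.sum_congr rfl fun B _ => ?_
    rw [sum_bijections_eq, sq, Finset.sum_mul]
    refine Finset.sum_congr rfl fun g hg => ?_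
    rw [← (Finset.mem_filter.mp hg).2, ← sum_perm_comp_eq g fun g => ∏ k, edgeInd G (f k) (g k),
      Finset.mul_sum]
    refine Finset.sum_congr rfl fun π _ => ?_
    rw [MatchingPair.edges, ← edgesPresent_mul, edgesPresent_pairEdges, edgesPresent_pairEdges]
  have hcard : ((pairsThrough m i).card : ℝ) =
      m.factorial * (n - 1).choose (m - 1) * (m.factorial * n.choose m * m.factorial) := by
    rw [pairsThrough, Finset.card_product, Finset.card_product]
    push_cast
    rw [card_embeddingsThrough hm, Finset.card_univ, Fintype.card_embedding_eq, Finset.card_univ,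
      Fintype.card_perm]
    simp only [Fintype.card_fin, Nat.descFactorial_eq_factorial_mul_choose]
    push_cast; rfl
  rw [← Finset.expect_div, Finset.expect_eq_sum_div_card, hsum, hcard, leftWeight]
  simp only [matchingStat, div_pow, ← Finset.sum_div]
  rw [mul_assoc (m.factorial : ℝ), mul_div_mul_left _ _ hfac, div_div, div_div]
  congr 1
  ring

/-! ### Means and covariances for given planted sets. -/

theorem integral_edgesPresent_plantedLaw {n : ℕ} (p : unitInterval) (A₀ B₀ : Finset (Fin n))
    (S : Finset (Fin n × Fin n)) :
    ∫ G, edgesPresent G S ∂(plantedLaw n p A₀ B₀) = (p : ℝ) ^ (S \ (A₀ ×ˢ B₀)).card := by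
  rw [plantedLaw, integral_map (Measurable.of_discrete).aemeasurable
    (Measurable.of_discrete).aestronglyMeasurable]
  have h1 : ∀ G : BipGraph n, edgesPresent (plantBiclique A₀ B₀ G) S =
      ∏ u, ∏ v, (if (u, v) ∈ S \ (A₀ ×ˢ B₀) then (if G u v = true then (1 : ℝ) else 0) else 1) := by
    intro G
    rw [← Fintype.prod_prod_type' fun u v => if (u, v) ∈ S \ (A₀ ×ˢ B₀) then
      (if G u v = true then (1 : ℝ) else 0) else 1, Finset.prod_ite_mem, Finset.univ_inter,
      edgesPresent, ← Finset.prod_sdiff (Finset.inter_subset_left (s₁ := S) (s₂ := A₀ ×ˢ B₀)),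
      Finset.sdiff_inter_self_left]
    rw [Finset.prod_eq_one (s := S ∩ A₀ ×ˢ B₀), mul_one]
    · refine Finset.prod_congr rfl fun e he => ?_
      rw [Finset.mem_sdiff, Finset.mem_product] at he
      simp [edgeInd, plantBiclique, he.2]
    · intro e he
      rw [Finset.mem_inter, Finset.mem_product] at he
      simp [edgeInd, plantBiclique, he.2]
  simp_rw [h1]
  rw [erLaw, integral_fintype_prod_eq_prod (fun u (x : Fin n → Bool) => ∏ v,
    (if (u, v) ∈ S \ (A₀ ×ˢ B₀) then (if x v = true then (1 : ℝ) else 0) else 1))]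
  have h2 : ∀ u : Fin n, ∫ x : Fin n → Bool, ∏ v, (if (u, v) ∈ S \ (A₀ ×ˢ B₀) then
      (if x v = true then (1 : ℝ) else 0) else 1) ∂(Measure.pi fun _ => bernoulliMeasure true false p)
      = ∏ v, if (u, v) ∈ S \ (A₀ ×ˢ B₀) then (p : ℝ) else 1 := by
    intro u
    rw [integral_fintype_prod_eq_prod (fun v (b : Bool) => if (u, v) ∈ S \ (A₀ ×ˢ B₀) then
      (if b = true then (1 : ℝ) else 0) else 1)]
    refine Finset.prod_congr rfl fun v _ => ?_
    rw [integral_bernoulliMeasure]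
    by_cases h : (u, v) ∈ S \ (A₀ ×ˢ B₀)
    · simp only [h, if_true]; simp
    · simp only [h, if_false]; simp
  simp_rw [h2]
  rw [← Fintype.prod_prod_type' fun u v => if (u, v) ∈ S \ (A₀ ×ˢ B₀) then (p : ℝ) else 1,
    Finset.prod_ite_mem, Finset.univ_inter, Finset.prod_const]

instance isProbabilityMeasure_erLaw (n : ℕ) (p : unitInterval) :
    IsProbabilityMeasure (erLaw n p) := by
  unfold erLaw; infer_instance

instance isProbabilityMeasure_plantedLaw (n : ℕ) (p : unitInterval) (A₀ B₀ : Finset (Fin n)) :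
    IsProbabilityMeasure (plantedLaw n p A₀ B₀) :=
  Measure.isProbabilityMeasure_map (Measurable.of_discrete).aemeasurable

theorem integral_finset_expect {Ω ι : Type*} [MeasurableSpace Ω] {μ : Measure Ω} (s : Finset ι)
    (F : ι → Ω → ℝ) (hF : ∀ i ∈ s, Integrable (F i) μ) :
    ∫ ω, 𝔼 i ∈ s, F i ω ∂μ = 𝔼 i ∈ s, ∫ ω, F i ω ∂μ := by
  simp only [Finset.expect_eq_sum_div_card]
  rw [integral_div, integral_finsetSum s hF]

theorem integral_leftWeight_plantedLaw {m n : ℕ} (hm : 1 ≤ m) (p : unitInterval)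
    (A₀ B₀ : Finset (Fin n)) (i : Fin n) :
    ∫ G, leftWeight p m G i ∂(plantedLaw n p A₀ B₀) =
      𝔼 c ∈ pairsThrough m i, (p : ℝ) ^ (c.edges \ (A₀ ×ˢ B₀)).card / (p : ℝ) ^ (2 * m) := by
  simp_rw [leftWeight_eq_expect hm]
  rw [integral_finset_expect _ _ fun c _ => .of_finite]
  simp_rw [integral_div, integral_edgesPresent_plantedLaw]

theorem integral_leftWeight_mul_plantedLaw {m n : ℕ} (hm : 1 ≤ m) (p : unitInterval)
    (A₀ B₀ : Finset (Fin n)) (i j : Fin n) :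
    ∫ G, leftWeight p m G i * leftWeight p m G j ∂(plantedLaw n p A₀ B₀) =
      𝔼 c ∈ pairsThrough m i, 𝔼 d ∈ pairsThrough m j,
        (p : ℝ) ^ ((c.edges ∪ d.edges) \ (A₀ ×ˢ B₀)).card / (p : ℝ) ^ (4 * m) := by
  simp_rw [leftWeight_eq_expect hm, Finset.expect_mul_expect]
  rw [integral_finset_expect _ _ fun c _ => .of_finite]
  refine Finset.expect_congr rfl fun c _ => ?_
  rw [integral_finset_expect _ _ fun c _ => .of_finite]
  refine Finset.expect_congr rfl fun d _ => ?_
  simp_rw [div_mul_div_comm, edgesPresent_mul]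
  rw [integral_div, integral_edgesPresent_plantedLaw]
  congr 1
  ring

theorem covariance_eq_integral_sub {Ω : Type*} [MeasurableSpace Ω] [Finite Ω]
    [DiscreteMeasurableSpace Ω] (μ : Measure Ω) [IsProbabilityMeasure μ] (X Y : Ω → ℝ) :
    covariance X Y μ = ∫ ω, X ω * Y ω ∂μ - (∫ ω, X ω ∂μ) * ∫ ω, Y ω ∂μ := by
  have h : ∀ Z : Ω → ℝ, MemLp Z 2 μ := fun Z => by
    obtain ⟨C, hC⟩ := (Set.finite_range fun ω => ‖Z ω‖).bddAbove
    exact MemLp.of_bound (Measurable.of_discrete).aestronglyMeasurable C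
      (.of_forall fun ω => hC ⟨ω, rfl⟩)
  rw [covariance_eq_sub (h X) (h Y)]
  rfl

theorem covariance_leftWeight_plantedLaw {m n : ℕ} (hm : 1 ≤ m) (p : unitInterval)
    (A₀ B₀ : Finset (Fin n)) (i j : Fin n) :
    covariance (fun G => leftWeight p m G i) (fun G => leftWeight p m G j)
        (plantedLaw n p A₀ B₀) =
      𝔼 c ∈ pairsThrough m i, 𝔼 d ∈ pairsThrough m j,
        ((p : ℝ) ^ ((c.edges ∪ d.edges) \ (A₀ ×ˢ B₀)).card -
          (p : ℝ) ^ (c.edges \ (A₀ ×ˢ B₀)).card * (p : ℝ) ^ (d.edges \ (A₀ ×ˢ B₀)).card) /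
            (p : ℝ) ^ (4 * m) := by
  rw [covariance_eq_integral_sub, integral_leftWeight_mul_plantedLaw hm,
    integral_leftWeight_plantedLaw hm, integral_leftWeight_plantedLaw hm, Finset.expect_mul_expect,
    ← Finset.expect_sub_distrib]
  refine Finset.expect_congr rfl fun c _ => ?_
  rw [← Finset.expect_sub_distrib]
  refine Finset.expect_congr rfl fun d _ => ?_
  rw [div_mul_div_comm, ← pow_add _ (2 * m), sub_div, show 2 * m + 2 * m = 4 * m by ring]

/-! ### Counting edges, and bounds for a single covariance term. -/

/-- The number of indices at which `a` and `b` agree. -/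
def agreements {m n : ℕ} (a b : Fin m → Fin n) : ℕ := ∑ k, if a k = b k then 1 else 0

/-- The number of indices that `a` sends into `B`. -/
def hits {m n : ℕ} (B : Finset (Fin n)) (a : Fin m → Fin n) : ℕ := ∑ k, if a k ∈ B then 1 else 0

/-- The number of pairs of indices giving a common edge of `f k ↦ a k` and `f' l ↦ a' l`. -/
def commonEdges {m n : ℕ} (f a f' a' : Fin m → Fin n) : ℕ :=
  ∑ k, ∑ l, if f k = f' l ∧ a k = a' l then 1 else 0

/-- The number of pairs of indices at which `f` and `f'` take the same value. -/
def commonValues {m n : ℕ} (f f' : Fin m → Fin n) : ℕ := ∑ k, ∑ l, if f k = f' l then 1 else 0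

theorem sum_ite_le_one {ι : Type*} [Fintype ι] (P : ι → Prop) [DecidablePred P]
    (h : ∀ x y, P x → P y → x = y) : ∑ x, (if P x then 1 else 0) ≤ 1 := by
  rw [← Finset.card_filter, Finset.card_le_one]
  intro x hx y hy
  exact h x y (Finset.mem_filter.mp hx).2 (Finset.mem_filter.mp hy).2

theorem sum_sum_ite_le_one {ι κ : Type*} [Fintype ι] [Fintype κ] (P : ι → κ → Prop)
    [∀ x, DecidablePred (P x)] (h : ∀ x y x' y', P x y → P x' y' → x = x' ∧ y = y') :
    ∑ x, ∑ y, (if P x y then 1 else 0) ≤ 1 := by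
  rw [← Fintype.sum_prod_type' fun x y => if P x y then 1 else 0]
  refine sum_ite_le_one (fun z : ι × κ => P z.1 z.2) fun x y hx hy => ?_
  exact Prod.ext_iff.mpr (h _ _ _ _ hx hy)

theorem agreements_comm {m n : ℕ} (a b : Fin m → Fin n) : agreements a b = agreements b a := by
  simp only [agreements, eq_comm]

theorem hits_comp_perm {m n : ℕ} (B : Finset (Fin n)) (a : Fin m → Fin n)
    (π : Equiv.Perm (Fin m)) : hits B (a ∘ π) = hits B a :=
  Equiv.sum_comp π fun k => if a k ∈ B then 1 else 0

theorem card_pairEdges {m n : ℕ} (f : Fin m ↪ Fin n) (a : Fin m → Fin n) :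
    (pairEdges f a).card = m := by
  rw [pairEdges, Finset.card_image_of_injective]
  · simp
  · intro k l h
    exact f.injective (Prod.ext_iff.mp h).1

theorem card_pairEdges_inter_le {m n : ℕ} (f a f' a' : Fin m → Fin n) :
    (pairEdges f a ∩ pairEdges f' a').card ≤ commonEdges f a f' a' := by
  rw [commonEdges, ← Fintype.sum_prod_type' fun k l => if f k = f' l ∧ a k = a' l then 1 else 0,
    ← Finset.card_filter]
  refine le_trans (Finset.card_le_card fun e he => ?_)
    (Finset.card_image_le (f := fun z : Fin m × Fin m => (f z.1, a z.1)))
  simp only [pairEdges, Finset.mem_inter, Finset.mem_image, Finset.mem_univ, true_and] at he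
  obtain ⟨⟨k, rfl⟩, l, hl⟩ := he
  simp only [Prod.mk.injEq] at hl
  exact Finset.mem_image.mpr ⟨(k, l), by simp [hl], rfl⟩

theorem card_pairEdges_inter_self {m n : ℕ} (f : Fin m ↪ Fin n) (a b : Fin m → Fin n) :
    (pairEdges f a ∩ pairEdges f b).card = agreements a b := by
  have : pairEdges f a ∩ pairEdges f b =
      (Finset.univ.filter fun k => a k = b k).image fun k => (f k, a k) := by
    ext e
    simp only [pairEdges, Finset.mem_inter, Finset.mem_image, Finset.mem_univ, true_and,
      Finset.mem_filter]
    constructor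
    · rintro ⟨⟨k, rfl⟩, l, hl⟩
      simp only [Prod.mk.injEq, EmbeddingLike.apply_eq_iff_eq] at hl
      obtain ⟨rfl, hl⟩ := hl
      exact ⟨l, hl.symm, rfl⟩
    · rintro ⟨k, hk, rfl⟩
      exact ⟨⟨k, rfl⟩, k, by rw [hk]⟩
  rw [this, Finset.card_image_of_injective, agreements, Finset.card_filter]
  intro k l h
  exact f.injective (Prod.ext_iff.mp h).1

theorem card_pairEdges_inter_product_le {m n : ℕ} (f a : Fin m → Fin n) (A₀ B₀ : Finset (Fin n)) :
    (pairEdges f a ∩ A₀ ×ˢ B₀).card ≤ hits B₀ a := by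
  rw [hits, ← Finset.card_filter]
  refine le_trans (Finset.card_le_card fun e he => ?_)
    (Finset.card_image_le (f := fun k : Fin m => (f k, a k)))
  simp only [pairEdges, Finset.mem_inter, Finset.mem_image, Finset.mem_univ, true_and,
    Finset.mem_product] at he
  obtain ⟨⟨k, rfl⟩, -, hk⟩ := he
  exact Finset.mem_image.mpr ⟨k, by simpa using hk, rfl⟩

theorem card_edges_add_agreements {m n : ℕ} (c : MatchingPair m n) :
    c.edges.card + agreements c.2.1 (c.2.1 ∘ c.2.2) = 2 * m := by
  rw [← card_pairEdges_inter_self c.1, MatchingPair.edges, Finset.card_union_add_card_inter,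
    card_pairEdges, card_pairEdges, two_mul]

theorem card_edges_sdiff_add_agreements_le {m n : ℕ} (c : MatchingPair m n)
    (P : Finset (Fin n × Fin n)) :
    (c.edges \ P).card + agreements c.2.1 (c.2.1 ∘ c.2.2) ≤ 2 * m := by
  rw [← card_edges_add_agreements c]
  gcongr
  exact Finset.sdiff_subset

/-- Edges are lost from `2m` only where the two matchings agree or where an edge is planted. A
planted edge is counted through its right endpoint alone, which makes the bound independent of `c.1`
and `A₀`. -/
theorem two_mul_le_card_edges_sdiff_add {m n : ℕ} (c : MatchingPair m n) (A₀ B₀ : Finset (Fin n)) :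
    2 * m ≤ (c.edges \ (A₀ ×ˢ B₀)).card +
      (agreements c.2.1 (c.2.1 ∘ c.2.2) + (hits B₀ c.2.1 + hits B₀ (c.2.1 ∘ c.2.2))) := by
  rw [← card_edges_add_agreements c, ← Finset.card_sdiff_add_card_inter c.edges (A₀ ×ˢ B₀)]
  have h : (c.edges ∩ A₀ ×ˢ B₀).card ≤ hits B₀ c.2.1 + hits B₀ (c.2.1 ∘ c.2.2) := by
    rw [MatchingPair.edges, Finset.union_inter_distrib_right]
    exact (Finset.card_union_le _ _).trans (add_le_add
      (card_pairEdges_inter_product_le _ _ _ _) (card_pairEdges_inter_product_le _ _ _ _))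
  omega

/-- The number of index pairs giving a common edge of two pairs of matchings. -/
def MatchingPair.common {m n : ℕ} (c d : MatchingPair m n) : ℕ :=
  commonEdges c.1 c.2.1 d.1 d.2.1 + commonEdges c.1 c.2.1 d.1 (d.2.1 ∘ d.2.2) +
    commonEdges c.1 (c.2.1 ∘ c.2.2) d.1 d.2.1 +
    commonEdges c.1 (c.2.1 ∘ c.2.2) d.1 (d.2.1 ∘ d.2.2)

theorem card_edges_inter_le {m n : ℕ} (c d : MatchingPair m n) :
    (c.edges ∩ d.edges).card ≤ c.common d := by
  rw [MatchingPair.edges, MatchingPair.edges, MatchingPair.common,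
    Finset.union_inter_distrib_right, Finset.inter_union_distrib_left,
    Finset.inter_union_distrib_left]
  have := card_pairEdges_inter_le c.1 c.2.1 d.1 d.2.1
  have := card_pairEdges_inter_le c.1 c.2.1 d.1 (d.2.1 ∘ d.2.2)
  have := card_pairEdges_inter_le c.1 (c.2.1 ∘ c.2.2) d.1 d.2.1
  have := card_pairEdges_inter_le c.1 (c.2.1 ∘ c.2.2) d.1 (d.2.1 ∘ d.2.2)
  refine (Finset.card_union_le _ _).trans ?_
  have := Finset.card_union_le (pairEdges c.1 c.2.1 ∩ pairEdges d.1 d.2.1)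
    (pairEdges c.1 c.2.1 ∩ pairEdges d.1 (d.2.1 ∘ d.2.2))
  have := Finset.card_union_le (pairEdges c.1 (c.2.1 ∘ c.2.2) ∩ pairEdges d.1 d.2.1)
    (pairEdges c.1 (c.2.1 ∘ c.2.2) ∩ pairEdges d.1 (d.2.1 ∘ d.2.2))
  omega

/-- For the lower bound it suffices to count edges shared by the first matchings of `c` and `d`.
Requiring the right endpoint to avoid `B₀` ensures that the edge is not planted. -/
theorem sum_common_off_le_card {m n : ℕ} (c d : MatchingPair m n) (A₀ B₀ : Finset (Fin n)) :
    ∑ k, ∑ l, (if c.1 k = d.1 l then (if c.2.1 k = d.2.1 l ∧ d.2.1 l ∉ B₀ then 1 else 0) else 0) ≤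
      ((c.edges ∩ d.edges) \ (A₀ ×ˢ B₀)).card := by
  simp only [← ite_and]
  rw [← Fintype.sum_prod_type' fun k l =>
    if c.1 k = d.1 l ∧ c.2.1 k = d.2.1 l ∧ d.2.1 l ∉ B₀ then 1 else 0, ← Finset.card_filter]
  refine Finset.card_le_card_of_injOn (fun z => (c.1 z.1, c.2.1 z.1)) ?_ ?_
  · rintro ⟨k, l⟩ h
    simp only [Finset.coe_filter, Finset.mem_univ, true_and, Set.mem_ofPred_eq] at h
    simp only [Finset.mem_coe, Finset.mem_sdiff, Finset.mem_inter, MatchingPair.edges,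
      Finset.mem_union, pairEdges, Finset.mem_image, Finset.mem_univ, true_and, Finset.mem_product]
    exact ⟨⟨Or.inl ⟨k, rfl⟩, Or.inl ⟨l, by rw [h.1, h.2.1]⟩⟩, fun h' => h.2.2 (h.2.1 ▸ h'.2)⟩
  · rintro ⟨k, l⟩ h ⟨k', l'⟩ h' heq
    simp only [Finset.coe_filter, Finset.mem_univ, true_and, Set.mem_ofPred_eq] at h h'
    have hk : k = k' := c.1.injective (Prod.ext_iff.mp heq).1
    subst hk
    have hl : l = l' := d.1.injective (h.1.symm.trans h'.1)
    rw [hl]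

theorem card_union_sdiff_add {α : Type*} [DecidableEq α] (S T P : Finset α) :
    ((S ∪ T) \ P).card + ((S ∩ T) \ P).card = (S \ P).card + (T \ P).card := by
  rw [Finset.union_sdiff_distrib, ← Finset.card_union_add_card_inter (S \ P) (T \ P)]
  congr 2
  ext x
  simp only [Finset.mem_sdiff, Finset.mem_inter]
  tauto

/-- The exponent that controls the covariance of two pairs of matchings. -/
def MatchingPair.excess {m n : ℕ} (B₀ : Finset (Fin n)) (c d : MatchingPair m n) : ℕ :=
  (agreements c.2.1 (c.2.1 ∘ c.2.2) + (hits B₀ c.2.1 + hits B₀ (c.2.1 ∘ c.2.2))) +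
    (agreements d.2.1 (d.2.1 ∘ d.2.2) + (hits B₀ d.2.1 + hits B₀ (d.2.1 ∘ d.2.2))) + c.common d

/-- The numerator is `p^u (1 - p^r)` with `r` the number of shared unplanted edges. Bernoulli gives
`1 - p^r ≤ r`, and `u ≥ 4m - excess`. -/
theorem covariance_term_le {m n : ℕ} {p : ℝ} (hp0 : 0 < p) (hp1 : p < 1) (A₀ B₀ : Finset (Fin n))
    (c d : MatchingPair m n) :
    (p ^ ((c.edges ∪ d.edges) \ (A₀ ×ˢ B₀)).card -
      p ^ (c.edges \ (A₀ ×ˢ B₀)).card * p ^ (d.edges \ (A₀ ×ˢ B₀)).card) / p ^ (4 * m) ≤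
      c.common d * p⁻¹ ^ c.excess B₀ d := by
  have h1 := card_union_sdiff_add c.edges d.edges (A₀ ×ˢ B₀)
  have h2 := two_mul_le_card_edges_sdiff_add c A₀ B₀
  have h3 := two_mul_le_card_edges_sdiff_add d A₀ B₀
  have h4 : ((c.edges ∩ d.edges) \ (A₀ ×ˢ B₀)).card ≤ c.common d :=
    (Finset.card_le_card Finset.sdiff_subset).trans (card_edges_inter_le c d)
  rw [← pow_add, ← h1]
  generalize ((c.edges ∪ d.edges) \ (A₀ ×ˢ B₀)).card = u at *
  generalize ((c.edges ∩ d.edges) \ (A₀ ×ˢ B₀)).card = r at *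
  have h5 : 4 * m ≤ u + c.excess B₀ d := by unfold MatchingPair.excess; omega
  have h6 : 1 - p ^ r ≤ r := by
    have := one_add_mul_le_pow (a := p - 1) (by linarith) r
    rw [add_sub_cancel] at this
    have hr : (0 : ℝ) ≤ r := by positivity
    nlinarith
  have h7 : p ^ u ≤ p⁻¹ ^ c.excess B₀ d * p ^ (4 * m) := by
    rw [inv_pow, inv_mul_eq_div, le_div_iff₀ (by positivity), ← pow_add]
    exact pow_le_pow_of_le_one hp0.le hp1.le h5
  rw [div_le_iff₀ (by positivity)]
  have h8 : (r : ℝ) ≤ c.common d := by exact_mod_cast h4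
  calc p ^ u - p ^ (u + r) = p ^ u * (1 - p ^ r) := by rw [pow_add]; ring
    _ ≤ p ^ u * c.common d := by gcongr; linarith
    _ ≤ p⁻¹ ^ c.excess B₀ d * p ^ (4 * m) * c.common d := by gcongr
    _ = _ := by ring

/-- The numerator is `p^(u + r) (L^r - 1)` with `L = 1/p`. Here `u + r ≤ 4m`, and Bernoulli gives
`L^r - 1 ≥ r (L - 1)`. -/
theorem le_covariance_term {m n : ℕ} {p : ℝ} (hp0 : 0 < p) (hp1 : p < 1) (A₀ B₀ : Finset (Fin n))
    (c d : MatchingPair m n) :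
    (p⁻¹ - 1) * ∑ k, ∑ l, (if c.1 k = d.1 l then
        (if c.2.1 k = d.2.1 l ∧ d.2.1 l ∉ B₀ then 1 else 0) else 0) ≤
    (p ^ ((c.edges ∪ d.edges) \ (A₀ ×ˢ B₀)).card -
      p ^ (c.edges \ (A₀ ×ˢ B₀)).card * p ^ (d.edges \ (A₀ ×ˢ B₀)).card) / p ^ (4 * m) := by
  have h1 := card_union_sdiff_add c.edges d.edges (A₀ ×ˢ B₀)
  have h2 := card_edges_sdiff_add_agreements_le c (A₀ ×ˢ B₀)
  have h3 := card_edges_sdiff_add_agreements_le d (A₀ ×ˢ B₀)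
  have h4 := sum_common_off_le_card c d A₀ B₀
  have hL : 1 < p⁻¹ := (one_lt_inv₀ hp0).mpr hp1
  have h4' : ∑ k, ∑ l, (if c.1 k = d.1 l then
        (if c.2.1 k = d.2.1 l ∧ d.2.1 l ∉ B₀ then (1 : ℝ) else 0) else 0) ≤
      ((c.edges ∩ d.edges) \ (A₀ ×ˢ B₀)).card := by exact_mod_cast h4
  refine (mul_le_mul_of_nonneg_left h4' (by linarith)).trans ?_
  rw [← pow_add, ← h1]
  have h5 : ((c.edges ∪ d.edges) \ (A₀ ×ˢ B₀)).card + ((c.edges ∩ d.edges) \ (A₀ ×ˢ B₀)).card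
      ≤ 4 * m := by omega
  generalize ((c.edges ∪ d.edges) \ (A₀ ×ˢ B₀)).card = u at *
  generalize ((c.edges ∩ d.edges) \ (A₀ ×ˢ B₀)).card = r at *
  have h6 : 1 + r * (p⁻¹ - 1) ≤ p⁻¹ ^ r := by
    have := one_add_mul_le_pow (a := p⁻¹ - 1) (by linarith) r
    rwa [add_sub_cancel] at this
  have h7 : p ^ (4 * m) ≤ p ^ (u + r) := pow_le_pow_of_le_one hp0.le hp1.le h5
  rw [le_div_iff₀ (by positivity)]
  calc (p⁻¹ - 1) * r * p ^ (4 * m) ≤ (p⁻¹ ^ r - 1) * p ^ (u + r) := by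
        gcongr
        · have := one_le_pow₀ hL.le (n := r); linarith
        · linarith
    _ = _ := by
        rw [pow_add, sub_mul, one_mul, inv_pow, mul_comm (p ^ u), ← mul_assoc,
          inv_mul_cancel₀ (by positivity), one_mul]

/-! ### Symmetries of the averages over pairs of matchings. -/

/-- The bijection `(g, π) ↦ (g ∘ π, π⁻¹)` exchanges the two matchings. -/
theorem expect_swap_matchings {m n : ℕ} (Φ : (Fin m → Fin n) → (Fin m → Fin n) → ℝ) :
    𝔼 g : Fin m ↪ Fin n, 𝔼 π : Equiv.Perm (Fin m), Φ g (g ∘ π) =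
      𝔼 g : Fin m ↪ Fin n, 𝔼 π : Equiv.Perm (Fin m), Φ (g ∘ π) g := by
  rw [Finset.expect_comm, Finset.expect_comm (s := Finset.univ (α := Fin m ↪ Fin n))]
  refine Fintype.expect_equiv (Equiv.inv _) _ _ fun π => ?_
  refine Fintype.expect_equiv (π.symm.embeddingCongr (Equiv.refl _)) _ _ fun g => ?_
  congr 1
  ext k
  simp [Equiv.embeddingCongr]

theorem expect_apply_eq {m n : ℕ} (hmn : m ≤ n) (k : Fin m) (v : Fin n) :
    𝔼 g : Fin m ↪ Fin n, (if g k = v then (1 : ℝ) else 0) = 1 / n := by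
  have : Nonempty (Fin m ↪ Fin n) := ⟨Fin.castLEEmb hmn⟩
  have hn : (n : ℝ) ≠ 0 := by
    have := v.pos
    positivity
  have hsymm : ∀ w, 𝔼 g : Fin m ↪ Fin n, (if g k = w then (1 : ℝ) else 0) =
      𝔼 g : Fin m ↪ Fin n, (if g k = v then (1 : ℝ) else 0) := by
    intro w
    refine Fintype.expect_equiv ((Equiv.refl _).embeddingCongr (Equiv.swap w v)) _ _ fun g => ?_
    have : (((Equiv.refl (Fin m)).embeddingCongr (Equiv.swap w v)) g) k = Equiv.swap w v (g k) := rfl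
    simp only [this, Equiv.swap_apply_eq_iff, Equiv.swap_apply_right]
  have hsum : ∑ w, 𝔼 g : Fin m ↪ Fin n, (if g k = w then (1 : ℝ) else 0) = 1 := by
    rw [← Finset.expect_sum_comm]
    simp
  simp_rw [hsymm] at hsum
  rw [Finset.sum_const, Finset.card_univ, Fintype.card_fin, nsmul_eq_mul] at hsum
  field_simp
  linarith

theorem expect_pairsThrough {m n : ℕ} (i : Fin n) (Φ : MatchingPair m n → ℝ) :
    𝔼 c ∈ pairsThrough m i, Φ c =
      𝔼 f ∈ embeddingsThrough m i, 𝔼 g : Fin m ↪ Fin n, 𝔼 π : Equiv.Perm (Fin m), Φ (f, g, π) := by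
  rw [pairsThrough, Finset.expect_product]
  exact Finset.expect_congr rfl fun f _ => Finset.expect_product _ _ _

theorem expect_expect_pairsThrough {m n : ℕ} (i j : Fin n)
    (Φ : MatchingPair m n → MatchingPair m n → ℝ) :
    𝔼 c ∈ pairsThrough m i, 𝔼 d ∈ pairsThrough m j, Φ c d =
      𝔼 f₁ ∈ embeddingsThrough m i, 𝔼 f₂ ∈ embeddingsThrough m j,
        𝔼 g₁ : Fin m ↪ Fin n, 𝔼 π₁ : Equiv.Perm (Fin m),
        𝔼 g₂ : Fin m ↪ Fin n, 𝔼 π₂ : Equiv.Perm (Fin m), Φ (f₁, g₁, π₁) (f₂, g₂, π₂) := by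
  rw [expect_pairsThrough]
  refine Finset.expect_congr rfl fun f₁ _ => ?_
  rw [Finset.expect_comm (s := embeddingsThrough m j)]
  refine Finset.expect_congr rfl fun g₁ _ => ?_
  rw [Finset.expect_comm (s := embeddingsThrough m j)]
  refine Finset.expect_congr rfl fun π₁ _ => ?_
  exact expect_pairsThrough j _

/-! ### The weighted and unweighted mean number of shared edges. -/

section MomentBounds

variable {m n : ℕ} {L : ℝ}

/-- These are the terms of `excess` that involve the first permutation, with `h₂` standing for `g₂ ∘
π₂`. They form a sum of entries `R k (π k)` in which each of the three terms contributes at most 1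
to an entry and at most 1 to a row. -/
theorem expect_perm_left_le (hL : 1 ≤ L) (f₁ f₂ g₁ g₂ h₂ : Fin m ↪ Fin n) :
    𝔼 π : Equiv.Perm (Fin m), L ^ (agreements g₁ (g₁ ∘ π) + commonEdges f₁ (g₁ ∘ π) f₂ g₂ +
      commonEdges f₁ (g₁ ∘ π) f₂ h₂) ≤ Real.exp ((L ^ 3 - 1) * 3) := by
  have h := expect_perm_pow_sum_le hL (fun k v : Fin m => (if g₁ k = g₁ v then 1 else 0) +
    (∑ l, if f₁ k = f₂ l ∧ g₁ v = g₂ l then 1 else 0) +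
    (∑ l, if f₁ k = f₂ l ∧ g₁ v = h₂ l then 1 else 0)) (d := 3) (D := 3) ?_ ?_
  · simpa only [Finset.sum_add_distrib, agreements, commonEdges, Function.comp_apply,
      Nat.cast_ofNat] using h
  · intro k v
    have h1 : (if g₁ k = g₁ v then 1 else 0) ≤ 1 := by split_ifs <;> simp
    have h2 := sum_ite_le_one (fun l => f₁ k = f₂ l ∧ g₁ v = g₂ l)
      fun x y hx hy => f₂.injective (hx.1.symm.trans hy.1)
    have h3 := sum_ite_le_one (fun l => f₁ k = f₂ l ∧ g₁ v = h₂ l)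
      fun x y hx hy => f₂.injective (hx.1.symm.trans hy.1)
    omega
  · intro k
    rw [Finset.sum_add_distrib, Finset.sum_add_distrib]
    have h1 := sum_ite_le_one (fun v => g₁ k = g₁ v)
      fun x y hx hy => g₁.injective (hx.symm.trans hy)
    have key : ∀ h : Fin m ↪ Fin n,
        ∑ v, ∑ l, (if f₁ k = f₂ l ∧ g₁ v = h l then 1 else 0) ≤ 1 := fun h =>
      sum_sum_ite_le_one (fun v l => f₁ k = f₂ l ∧ g₁ v = h l) fun x y x' y' hx hy => by
        have hl := f₂.injective (hx.1.symm.trans hy.1)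
        exact ⟨g₁.injective (hx.2.trans (hl ▸ hy.2.symm)), hl⟩
    have h2 := key g₂
    have h3 := key h₂
    omega

/-- The terms left for the second permutation once the first is averaged out. Entries and rows are
at most 2; the larger value 3 gives the same constant as for the first permutation. -/
theorem expect_perm_right_le (hL : 1 ≤ L) (f₁ f₂ g₁ g₂ : Fin m ↪ Fin n) :
    𝔼 π : Equiv.Perm (Fin m), L ^ (agreements g₂ (g₂ ∘ π) + commonEdges f₁ g₁ f₂ (g₂ ∘ π)) ≤
      Real.exp ((L ^ 3 - 1) * 3) := by
  have h := expect_perm_pow_sum_le hL (fun l v : Fin m => (if g₂ l = g₂ v then 1 else 0) +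
    (∑ k, if f₁ k = f₂ l ∧ g₁ k = g₂ v then 1 else 0)) (d := 3) (D := 3) ?_ ?_
  · simp only [Finset.sum_add_distrib] at h
    rw [Finset.expect_congr rfl fun π _ => by
      rw [Finset.sum_comm (γ := Fin m) (f := fun l k => if f₁ k = f₂ l ∧ g₁ k = g₂ (π l) then 1 else 0)]] at h
    exact_mod_cast h
  · intro k v
    have h1 : (if g₂ k = g₂ v then 1 else 0) ≤ 1 := by split_ifs <;> simp
    have h2 := sum_ite_le_one (fun l => f₁ l = f₂ k ∧ g₁ l = g₂ v)
      fun x y hx hy => f₁.injective (hx.1.trans hy.1.symm)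
    omega
  · intro k
    rw [Finset.sum_add_distrib]
    have h1 := sum_ite_le_one (fun v => g₂ k = g₂ v)
      fun x y hx hy => g₂.injective (hx.symm.trans hy)
    have h2 := sum_sum_ite_le_one (fun v l => f₁ l = f₂ k ∧ g₁ l = g₂ v) fun x y x' y' hx hy => by
        have hl := f₁.injective (hx.1.trans hy.1.symm)
        exact ⟨g₂.injective (hx.2.symm.trans (hl ▸ hy.2)), hl⟩
    omega

theorem expect_pow_hits_le (hL : 1 ≤ L) (hmn : m ≤ n) (B : Finset (Fin n)) :
    𝔼 g : Fin m ↪ Fin n, L ^ (2 * hits B g) ≤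
      Real.exp ((L ^ 2 - 1) * (2 * B.card : ℕ) * m / n) := by
  have h := expect_embedding_pow_sum_le (α := Fin m) (β := Fin n) (by simpa using hmn) hL
    (fun k v => 2 * if v ∈ B then 1 else 0) (d := 2) (D := 2 * B.card) ?_ ?_
  · simpa only [← Finset.mul_sum, Fintype.card_fin, hits] using h
  · intro k v; split_ifs <;> simp
  · intro k; simp [mul_comm]

/-- `commonEdges` is a sum of events `g₂ l = g₁ k` over the index pairs with `f₁ k = f₂ l`. There
are `commonValues f₁ f₂` such pairs, and the pinned moment bound makes each of them `O(1/n)`. -/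
theorem expect_commonEdges_mul_pow_le (hL : 1 ≤ L) (hmn : m ≤ n) (B : Finset (Fin n))
    (f₁ f₂ g₁ : Fin m ↪ Fin n) :
    𝔼 g₂ : Fin m ↪ Fin n, (commonEdges f₁ g₁ f₂ g₂ : ℝ) *
      L ^ (commonEdges f₁ g₁ f₂ g₂ + 2 * hits B g₂) ≤
      commonValues f₁ f₂ * ((1 + (L ^ 3 - 1) * 3) / n *
        Real.exp ((L ^ 3 - 1) * (1 + 2 * B.card : ℕ) * m / n)) := by
  let R : Fin m → Fin n → ℕ := fun l v =>
    (∑ k, if f₁ k = f₂ l ∧ g₁ k = v then 1 else 0) + 2 * if v ∈ B then 1 else 0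
  have h := fun l v => expect_embedding_ite_mul_pow_sum_le (α := Fin m) (β := Fin n)
    (by simpa using hmn) hL R (d := 3) (D := 1 + 2 * B.card) ?_ ?_ l v
  · simp only [Fintype.card_fin] at h
    have hR : ∀ g₂ : Fin m ↪ Fin n, ∑ l, R l (g₂ l) =
        commonEdges f₁ g₁ f₂ g₂ + 2 * hits B g₂ := by
      intro g₂
      simp only [R, commonEdges, hits, Finset.sum_add_distrib, ← Finset.mul_sum]
      rw [Finset.sum_comm]
    calc 𝔼 g₂ : Fin m ↪ Fin n, (commonEdges f₁ g₁ f₂ g₂ : ℝ) *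
          L ^ (commonEdges f₁ g₁ f₂ g₂ + 2 * hits B g₂)
        = 𝔼 g₂ : Fin m ↪ Fin n, ∑ k, ∑ l, (if f₁ k = f₂ l then
            (if g₂ l = g₁ k then 1 else 0) * L ^ ∑ l, R l (g₂ l) else 0) := by
          refine Finset.expect_congr rfl fun g₂ _ => ?_
          rw [hR, commonEdges]
          push_cast
          simp only [Finset.sum_mul]
          refine Finset.sum_congr rfl fun k _ => Finset.sum_congr rfl fun l _ => ?_
          by_cases h1 : f₁ k = f₂ l <;> by_cases h2 : g₁ k = g₂ l <;> simp [h1, h2, eq_comm]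
      _ = ∑ k, ∑ l, (if f₁ k = f₂ l then
            𝔼 g₂ : Fin m ↪ Fin n, (if g₂ l = g₁ k then 1 else 0) * L ^ ∑ l, R l (g₂ l) else 0) := by
          rw [Finset.expect_sum_comm]
          refine Finset.sum_congr rfl fun k _ => ?_
          rw [Finset.expect_sum_comm]
          refine Finset.sum_congr rfl fun l _ => ?_
          split_ifs <;> simp
      _ ≤ ∑ k, ∑ l, (if f₁ k = f₂ l then ((1 + (L ^ 3 - 1) * 3) / n *
            Real.exp ((L ^ 3 - 1) * (1 + 2 * B.card : ℕ) * m / n)) else 0) := by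
          refine Finset.sum_le_sum fun k _ => Finset.sum_le_sum fun l _ => ?_
          split_ifs
          · exact_mod_cast h l (g₁ k)
          · exact le_rfl
      _ = _ := by
          rw [commonValues]
          push_cast
          simp only [Finset.sum_mul, ite_mul, one_mul, zero_mul]
  · intro l v
    have h2 := sum_ite_le_one (fun k => f₁ k = f₂ l ∧ g₁ k = v)
      fun x y hx hy => f₁.injective (hx.1.trans hy.1.symm)
    simp only [R]
    split_ifs <;> omega
  · intro l
    have h2 := sum_sum_ite_le_one (fun v k => f₁ k = f₂ l ∧ g₁ k = v) fun x y x' y' hx hy => by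
        have hl := f₁.injective (hx.1.trans hy.1.symm)
        exact ⟨hx.2.symm.trans (hl ▸ hy.2), hl⟩
    simp only [R, Finset.sum_add_distrib, ← Finset.mul_sum]
    simp only [Finset.sum_ite_mem, Finset.univ_inter, Finset.sum_const, smul_eq_mul, mul_one]
    omega

/-- The constant that bounds the average of `commonEdges * L ^ excess`. -/
noncomputable def momentConst (L : ℝ) (m n K : ℕ) : ℝ :=
  Real.exp ((L ^ 3 - 1) * 3) ^ 2 * (1 + (L ^ 3 - 1) * 3) *
    Real.exp ((L ^ 3 - 1) * (1 + 2 * K : ℕ) * m / n) * Real.exp ((L ^ 2 - 1) * (2 * K : ℕ) * m / n)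

theorem expect_commonEdges_mul_pow_excess_le (hL : 1 ≤ L) (hmn : m ≤ n) (B : Finset (Fin n))
    (f₁ f₂ : Fin m ↪ Fin n) :
    𝔼 g₁ : Fin m ↪ Fin n, 𝔼 π₁ : Equiv.Perm (Fin m),
      𝔼 g₂ : Fin m ↪ Fin n, 𝔼 π₂ : Equiv.Perm (Fin m), (commonEdges f₁ g₁ f₂ g₂ : ℝ) *
        L ^ MatchingPair.excess B (f₁, g₁, π₁) (f₂, g₂, π₂) ≤
      momentConst L m n B.card * (commonValues f₁ f₂ / n) := by
  have hL0 : 0 ≤ L := by linarith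
  have hL3 : 0 ≤ L ^ 3 - 1 := by have := one_le_pow₀ hL (n := 3); linarith
  set E := Real.exp ((L ^ 3 - 1) * 3)
  have hE : 0 ≤ E := (Real.exp_pos _).le
  -- The exponent is split so that `π₁`, `π₂`, `g₂`, `g₁` can be averaged out in this order; the
  -- average over `g₂` supplies the factor `commonValues / n`. Permuting does not change `hits`,
  -- hence the doubled hits.
  calc _ = 𝔼 g₁ : Fin m ↪ Fin n, 𝔼 g₂ : Fin m ↪ Fin n, 𝔼 π₂ : Equiv.Perm (Fin m),
          𝔼 π₁ : Equiv.Perm (Fin m), L ^ (2 * hits B g₁) * ((commonEdges f₁ g₁ f₂ g₂ : ℝ) *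
            L ^ (commonEdges f₁ g₁ f₂ g₂ + 2 * hits B g₂)) *
            L ^ (agreements g₂ (g₂ ∘ π₂) + commonEdges f₁ g₁ f₂ (g₂ ∘ π₂)) *
            L ^ (agreements g₁ (g₁ ∘ π₁) + commonEdges f₁ (g₁ ∘ π₁) f₂ g₂ +
              commonEdges f₁ (g₁ ∘ π₁) f₂ (π₂.toEmbedding.trans g₂)) := by
        refine Finset.expect_congr rfl fun g₁ _ => ?_
        rw [Finset.expect_comm]
        refine Finset.expect_congr rfl fun g₂ _ => ?_
        rw [Finset.expect_comm]
        refine Finset.expect_congr rfl fun π₂ _ => Finset.expect_congr rfl fun π₁ _ => ?_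
        have : ((π₂.toEmbedding.trans g₂ : Fin m ↪ Fin n) : Fin m → Fin n) = g₂ ∘ π₂ := rfl
        rw [this, MatchingPair.excess, MatchingPair.common, hits_comp_perm, hits_comp_perm]
        simp only [pow_add, two_mul]
        ring
    _ ≤ 𝔼 g₁ : Fin m ↪ Fin n, 𝔼 g₂ : Fin m ↪ Fin n, 𝔼 π₂ : Equiv.Perm (Fin m),
          L ^ (2 * hits B g₁) * ((commonEdges f₁ g₁ f₂ g₂ : ℝ) *
            L ^ (commonEdges f₁ g₁ f₂ g₂ + 2 * hits B g₂)) *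
            L ^ (agreements g₂ (g₂ ∘ π₂) + commonEdges f₁ g₁ f₂ (g₂ ∘ π₂)) * E := by
        refine Finset.expect_le_expect fun g₁ _ => Finset.expect_le_expect fun g₂ _ =>
          Finset.expect_le_expect fun π₂ _ => ?_
        rw [← Finset.mul_expect]
        gcongr
        exact expect_perm_left_le hL f₁ f₂ g₁ g₂ _
    _ ≤ 𝔼 g₁ : Fin m ↪ Fin n, 𝔼 g₂ : Fin m ↪ Fin n,
          L ^ (2 * hits B g₁) * ((commonEdges f₁ g₁ f₂ g₂ : ℝ) *
            L ^ (commonEdges f₁ g₁ f₂ g₂ + 2 * hits B g₂)) * E * E := by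
        refine Finset.expect_le_expect fun g₁ _ => Finset.expect_le_expect fun g₂ _ => ?_
        rw [← Finset.expect_mul, ← Finset.mul_expect]
        gcongr
        exact expect_perm_right_le hL f₁ f₂ g₁ g₂
    _ ≤ 𝔼 g₁ : Fin m ↪ Fin n, L ^ (2 * hits B g₁) *
          (commonValues f₁ f₂ * ((1 + (L ^ 3 - 1) * 3) / n *
        Real.exp ((L ^ 3 - 1) * (1 + 2 * B.card : ℕ) * m / n))) * E * E := by
        refine Finset.expect_le_expect fun g₁ _ => ?_
        rw [← Finset.expect_mul, ← Finset.expect_mul, ← Finset.mul_expect]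
        gcongr
        exact expect_commonEdges_mul_pow_le hL hmn B f₁ f₂ g₁
    _ ≤ Real.exp ((L ^ 2 - 1) * (2 * B.card : ℕ) * m / n) *
          (commonValues f₁ f₂ * ((1 + (L ^ 3 - 1) * 3) / n *
        Real.exp ((L ^ 3 - 1) * (1 + 2 * B.card : ℕ) * m / n))) * E * E := by
        rw [← Finset.expect_mul, ← Finset.expect_mul, ← Finset.expect_mul]
        gcongr
        exact expect_pow_hits_le hL hmn B
    _ = _ := by rw [momentConst]; ring

theorem expect_symmetrize_matchings
    (Φ : (Fin m → Fin n) → (Fin m → Fin n) → (Fin m → Fin n) → (Fin m → Fin n) → ℝ) :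
    𝔼 g₁ : Fin m ↪ Fin n, 𝔼 π₁ : Equiv.Perm (Fin m),
      𝔼 g₂ : Fin m ↪ Fin n, 𝔼 π₂ : Equiv.Perm (Fin m),
        (Φ g₁ (g₁ ∘ π₁) g₂ (g₂ ∘ π₂) + Φ g₁ (g₁ ∘ π₁) (g₂ ∘ π₂) g₂ +
          Φ (g₁ ∘ π₁) g₁ g₂ (g₂ ∘ π₂) + Φ (g₁ ∘ π₁) g₁ (g₂ ∘ π₂) g₂) =
      4 * 𝔼 g₁ : Fin m ↪ Fin n, 𝔼 π₁ : Equiv.Perm (Fin m),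
        𝔼 g₂ : Fin m ↪ Fin n, 𝔼 π₂ : Equiv.Perm (Fin m), Φ g₁ (g₁ ∘ π₁) g₂ (g₂ ∘ π₂) := by
  have h1 : ∀ a b : Fin m → Fin n,
      𝔼 g₂ : Fin m ↪ Fin n, 𝔼 π₂ : Equiv.Perm (Fin m), Φ a b (g₂ ∘ π₂) g₂ =
        𝔼 g₂ : Fin m ↪ Fin n, 𝔼 π₂ : Equiv.Perm (Fin m), Φ a b g₂ (g₂ ∘ π₂) := fun a b =>
    (expect_swap_matchings fun a' b' => Φ a b a' b').symm
  have h2 := expect_swap_matchings fun a b : Fin m → Fin n =>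
    𝔼 g₂ : Fin m ↪ Fin n, 𝔼 π₂ : Equiv.Perm (Fin m), Φ a b g₂ (g₂ ∘ π₂)
  simp only [Finset.expect_add_distrib, h1]
  rw [← h2]
  ring

/-- `excess` is invariant under exchanging the two matchings of either pair, so the four summands of
`common` have equal weighted averages. -/
theorem expect_common_mul_pow_excess_le (hL : 1 ≤ L) (hmn : m ≤ n) (B : Finset (Fin n))
    (f₁ f₂ : Fin m ↪ Fin n) :
    𝔼 g₁ : Fin m ↪ Fin n, 𝔼 π₁ : Equiv.Perm (Fin m),
      𝔼 g₂ : Fin m ↪ Fin n, 𝔼 π₂ : Equiv.Perm (Fin m),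
        (MatchingPair.common (f₁, g₁, π₁) (f₂, g₂, π₂) : ℝ) *
        L ^ MatchingPair.excess B (f₁, g₁, π₁) (f₂, g₂, π₂) ≤
      4 * (momentConst L m n B.card * (commonValues f₁ f₂ / n)) := by
  refine le_of_eq_of_le ?_ (mul_le_mul_of_nonneg_left
    (expect_commonEdges_mul_pow_excess_le hL hmn B f₁ f₂) (by norm_num))
  simp only [MatchingPair.excess, MatchingPair.common]
  rw [← expect_symmetrize_matchings fun a₁ b₁ a₂ b₂ => (commonEdges f₁ a₁ f₂ a₂ : ℝ) *
    L ^ ((agreements a₁ b₁ + (hits B a₁ + hits B b₁)) +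
      (agreements a₂ b₂ + (hits B a₂ + hits B b₂)) +
      (commonEdges f₁ a₁ f₂ a₂ + commonEdges f₁ a₁ f₂ b₂ + commonEdges f₁ b₁ f₂ a₂ +
        commonEdges f₁ b₁ f₂ b₂))]
  refine Finset.expect_congr rfl fun g₁ _ => Finset.expect_congr rfl fun π₁ _ =>
    Finset.expect_congr rfl fun g₂ _ => Finset.expect_congr rfl fun π₂ _ => ?_
  rw [agreements_comm (g₁ ∘ π₁), agreements_comm (g₂ ∘ π₂)]
  simp only [pow_add]
  push_cast
  ring

theorem expect_sum_common_off (hmn : m ≤ n) (B : Finset (Fin n)) (f₁ f₂ : Fin m ↪ Fin n) :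
    𝔼 g₁ : Fin m ↪ Fin n, 𝔼 _π₁ : Equiv.Perm (Fin m),
      𝔼 g₂ : Fin m ↪ Fin n, 𝔼 _π₂ : Equiv.Perm (Fin m), ∑ k, ∑ l, (if f₁ k = f₂ l then
        (if g₁ k = g₂ l ∧ g₂ l ∉ B then (1 : ℝ) else 0) else 0) =
      commonValues f₁ f₂ * ((n - B.card) / n / n) := by
  have key : ∀ k l, 𝔼 g₁ : Fin m ↪ Fin n, 𝔼 g₂ : Fin m ↪ Fin n,
      (if g₁ k = g₂ l ∧ g₂ l ∉ B then (1 : ℝ) else 0) = (n - B.card) / n / n := by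
    intro k l
    rw [Finset.expect_comm]
    calc 𝔼 g₂ : Fin m ↪ Fin n, 𝔼 g₁ : Fin m ↪ Fin n,
          (if g₁ k = g₂ l ∧ g₂ l ∉ B then (1 : ℝ) else 0)
        = 𝔼 g₂ : Fin m ↪ Fin n, (∑ v ∈ Bᶜ, if g₂ l = v then (1 : ℝ) else 0) * (1 / n) := by
          refine Finset.expect_congr rfl fun g₂ _ => ?_
          rw [Finset.sum_ite_eq, ← expect_apply_eq hmn k (g₂ l)]
          by_cases h : g₂ l ∈ B <;> simp [h]
      _ = _ := by
          rw [← Finset.expect_mul, Finset.expect_sum_comm]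
          simp_rw [expect_apply_eq hmn l]
          rw [Finset.sum_const, Finset.card_compl, nsmul_eq_mul, Fintype.card_fin,
            Nat.cast_sub (by simpa using B.card_le_univ)]
          ring
  simp only [Fintype.expect_const, Finset.expect_sum_comm]
  rw [commonValues]
  push_cast
  simp only [Finset.sum_mul]
  refine Finset.sum_congr rfl fun k _ => Finset.sum_congr rfl fun l _ => ?_
  split_ifs
  · rw [key, one_mul]
  · simp

end MomentBounds

/-! ### The mean number of common left vertices. -/

section CommonValues

variable {m n : ℕ}

theorem embeddingsThrough_nonempty (hm : 1 ≤ m) (hmn : m ≤ n) (i : Fin n) :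
    (embeddingsThrough m i).Nonempty := by
  rw [← Finset.card_pos]
  have h := card_embeddingsThrough hm i
  have h1 : 0 < (n - 1).choose (m - 1) := Nat.choose_pos (by omega)
  have h2 : (0 : ℝ) < (embeddingsThrough m i).card := by rw [h]; positivity
  exact_mod_cast h2

theorem mem_map_embeddingCongr (ρ : Equiv.Perm (Fin n)) (f : Fin m ↪ Fin n) (v : Fin n) :
    v ∈ Finset.univ.map ((Equiv.refl (Fin m)).embeddingCongr ρ f) ↔
      ρ.symm v ∈ Finset.univ.map f := by
  simp [Equiv.embeddingCongr, Equiv.eq_symm_apply]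

theorem expect_mem_map_self (hm : 1 ≤ m) (hmn : m ≤ n) (i : Fin n) :
    𝔼 f ∈ embeddingsThrough m i, (if i ∈ Finset.univ.map f then (1 : ℝ) else 0) = 1 := by
  rw [Finset.expect_congr rfl (g := fun _ => (1 : ℝ)),
    Finset.expect_const (embeddingsThrough_nonempty hm hmn i)]
  intro f hf
  rw [if_pos (Finset.mem_filter.mp hf).2]

/-- By symmetry all vertices other than `i` are covered with the same probability `q`, and `1 + (n -
1) q = m`. -/
theorem expect_mem_map_eq (hm : 1 ≤ m) (hmn : m ≤ n) {i u : Fin n} (hu : u ≠ i) :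
    𝔼 f ∈ embeddingsThrough m i, (if u ∈ Finset.univ.map f then (1 : ℝ) else 0) =
      ((m : ℝ) - 1) / ((n : ℝ) - 1) := by
  have hne := embeddingsThrough_nonempty hm hmn i
  have hn : (n : ℝ) - 1 ≠ 0 := by
    have : 1 < n := by
      by_contra h
      exact hu (Fin.ext (by omega))
    have : (1 : ℝ) < n := by exact_mod_cast this
    linarith
  have hsymm : ∀ w ∈ Finset.univ.erase i,
      𝔼 f ∈ embeddingsThrough m i, (if w ∈ Finset.univ.map f then (1 : ℝ) else 0) =
        𝔼 f ∈ embeddingsThrough m i, (if u ∈ Finset.univ.map f then (1 : ℝ) else 0) := by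
    intro w hw
    have hw : w ≠ i := (Finset.mem_erase.mp hw).1
    refine Finset.expect_equiv ((Equiv.refl _).embeddingCongr (Equiv.swap w u)) ?_ ?_
    · intro f
      simp only [embeddingsThrough, Finset.mem_filter, Finset.mem_univ, true_and]
      rw [mem_map_embeddingCongr, Equiv.symm_swap, Equiv.swap_apply_of_ne_of_ne hw.symm hu.symm]
    · intro f _
      simp only [mem_map_embeddingCongr, Equiv.symm_swap, Equiv.swap_apply_right]
  have hsum : ∑ w, 𝔼 f ∈ embeddingsThrough m i,
      (if w ∈ Finset.univ.map f then (1 : ℝ) else 0) = m := by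
    rw [← Finset.expect_sum_comm, Finset.expect_congr rfl (g := fun _ => (m : ℝ)),
      Finset.expect_const hne]
    intro f _
    rw [Finset.sum_ite_mem, Finset.univ_inter, Finset.sum_const, Finset.card_map]
    simp
  rw [← Finset.add_sum_erase _ _ (Finset.mem_univ i), Finset.sum_congr rfl hsymm,
    expect_mem_map_self hm hmn,
    Finset.sum_const, Finset.card_erase_of_mem (Finset.mem_univ i), Finset.card_univ,
    Fintype.card_fin, nsmul_eq_mul, Nat.cast_sub i.pos] at hsum
  rw [eq_div_iff hn]
  push_cast at hsum
  linarith

theorem commonValues_eq_sum (f₁ f₂ : Fin m ↪ Fin n) :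
    (commonValues f₁ f₂ : ℝ) = ∑ u, (if u ∈ Finset.univ.map f₁ then (1 : ℝ) else 0) *
      (if u ∈ Finset.univ.map f₂ then (1 : ℝ) else 0) := by
  have h : ∀ (f : Fin m ↪ Fin n) (u : Fin n), (if u ∈ Finset.univ.map f then (1 : ℝ) else 0) =
      ∑ k, if f k = u then (1 : ℝ) else 0 := by
    intro f u
    split_ifs with hu
    · obtain ⟨k, -, rfl⟩ := Finset.mem_map.mp hu
      simp
    · rw [Finset.sum_eq_zero]
      intro k _
      rw [if_neg]
      rintro rfl
      exact hu (Finset.mem_map_of_mem f (Finset.mem_univ k))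
  simp_rw [h, Finset.sum_mul_sum]
  rw [Finset.sum_comm, commonValues]
  push_cast
  refine Finset.sum_congr rfl fun k _ => ?_
  rw [Finset.sum_comm]
  refine Finset.sum_congr rfl fun l _ => ?_
  simp [eq_comm]

/-- The average number of common values of two random injections through `i` and `j`. -/
noncomputable def meanCommon (m : ℕ) {n : ℕ} (i j : Fin n) : ℝ :=
  𝔼 f₁ ∈ embeddingsThrough m i, 𝔼 f₂ ∈ embeddingsThrough m j, (commonValues f₁ f₂ : ℝ)

/-- The two injections are independent, so each vertex contributes the product of its two covering
probabilities. -/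
theorem meanCommon_eq_sum (i j : Fin n) : meanCommon m i j =
    ∑ u, (𝔼 f ∈ embeddingsThrough m i, (if u ∈ Finset.univ.map f then (1 : ℝ) else 0)) *
      𝔼 f ∈ embeddingsThrough m j, (if u ∈ Finset.univ.map f then (1 : ℝ) else 0) := by
  simp_rw [meanCommon, commonValues_eq_sum, Finset.expect_sum_comm, Finset.expect_mul_expect]

theorem meanCommon_self (hm : 1 ≤ m) (hmn : m ≤ n) (i : Fin n) :
    meanCommon m i i = 1 + ((n : ℝ) - 1) * (((m : ℝ) - 1) / ((n : ℝ) - 1)) ^ 2 := by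
  rw [meanCommon_eq_sum, ← Finset.add_sum_erase _ _ (Finset.mem_univ i),
    expect_mem_map_self hm hmn, Finset.sum_congr rfl (g := fun _ =>
      (((m : ℝ) - 1) / ((n : ℝ) - 1)) ^ 2), Finset.sum_const,
    Finset.card_erase_of_mem (Finset.mem_univ i), Finset.card_univ,
    Fintype.card_fin, nsmul_eq_mul, Nat.cast_sub i.pos]
  · push_cast; ring
  · intro u hu
    rw [expect_mem_map_eq hm hmn (Finset.mem_erase.mp hu).1, sq]

theorem meanCommon_of_ne (hm : 1 ≤ m) (hmn : m ≤ n) {i j : Fin n} (hij : i ≠ j) :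
    meanCommon m i j = 2 * (((m : ℝ) - 1) / ((n : ℝ) - 1)) +
      ((n : ℝ) - 2) * (((m : ℝ) - 1) / ((n : ℝ) - 1)) ^ 2 := by
  have hj : j ∈ Finset.univ.erase i := Finset.mem_erase.mpr ⟨hij.symm, Finset.mem_univ j⟩
  have hn : 2 ≤ n := by
    by_contra h
    exact hij (Fin.ext (by omega))
  rw [meanCommon_eq_sum, ← Finset.add_sum_erase _ _ (Finset.mem_univ i),
    ← Finset.add_sum_erase _ _ hj, expect_mem_map_self hm hmn, expect_mem_map_self hm hmn,
    expect_mem_map_eq hm hmn hij, expect_mem_map_eq hm hmn hij.symm,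
    Finset.sum_congr rfl (g := fun _ => (((m : ℝ) - 1) / ((n : ℝ) - 1)) ^ 2), Finset.sum_const,
    Finset.card_erase_of_mem hj, Finset.card_erase_of_mem (Finset.mem_univ i), Finset.card_univ,
    Fintype.card_fin, nsmul_eq_mul, Nat.sub_sub, Nat.cast_sub hn]
  · push_cast; ring
  · intro u hu
    rw [Finset.mem_erase, Finset.mem_erase] at hu
    rw [expect_mem_map_eq hm hmn hu.1, expect_mem_map_eq hm hmn hu.2.1, sq]

theorem meanCommon_self_bounds (hm : 1 ≤ m) (hmn : m ^ 2 ≤ n) (i : Fin n) :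
    1 ≤ meanCommon m i i ∧ meanCommon m i i ≤ 2 := by
  have hle : m ≤ n := le_trans (by nlinarith) hmn
  rw [meanCommon_self hm hle]
  have h1 : (1 : ℝ) ≤ m := by exact_mod_cast hm
  have h2 : (m : ℝ) ^ 2 ≤ n := by exact_mod_cast hmn
  have h3 : (0 : ℝ) ≤ (n : ℝ) - 1 := by nlinarith
  refine ⟨by have := mul_nonneg h3 (sq_nonneg (((m : ℝ) - 1) / ((n : ℝ) - 1))); linarith, ?_⟩
  rcases h3.eq_or_lt with h4 | h4
  · rw [← h4]; norm_num
  · have : ((n : ℝ) - 1) * (((m : ℝ) - 1) / ((n : ℝ) - 1)) ^ 2 = ((m : ℝ) - 1) ^ 2 / ((n : ℝ) - 1) := by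
      field_simp
    rw [this]
    have : ((m : ℝ) - 1) ^ 2 / ((n : ℝ) - 1) ≤ 1 := by
      rw [div_le_one h4]; nlinarith
    linarith

/-- Here `m ≥ 2` is essential: it gives `m - 1 ≥ m/2`, hence `q ≥ m/(2n)`, whereas for `m = 1` the
mean is 0. Since `q ≤ 1`, the term `2q` dominates `2q²`, so the mean is at least `n q²`. -/
theorem meanCommon_bounds_of_ne (hm : 2 ≤ m) (hmn : m ≤ n) {i j : Fin n} (hij : i ≠ j) :
    (m : ℝ) ^ 2 / (4 * n) ≤ meanCommon m i j ∧ meanCommon m i j ≤ 2 * m ^ 2 / n := by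
  rw [meanCommon_of_ne (by omega) hmn hij]
  have h1 : (2 : ℝ) ≤ m := by exact_mod_cast hm
  have h2 : (m : ℝ) ≤ n := by exact_mod_cast hmn
  set q : ℝ := ((m : ℝ) - 1) / ((n : ℝ) - 1) with hq
  have hn1 : (0 : ℝ) < (n : ℝ) - 1 := by linarith
  have hn0 : (0 : ℝ) < n := by linarith
  have hq0 : 0 ≤ q := div_nonneg (by linarith) hn1.le
  have hq1 : q ≤ m / n := by
    rw [hq, div_le_div_iff₀ hn1 hn0]; nlinarith
  have hq2 : (m : ℝ) / (2 * n) ≤ q := by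
    rw [hq, div_le_div_iff₀ (by positivity) hn1]; nlinarith
  have hq3 : q ≤ 1 := hq1.trans ((div_le_one hn0).mpr h2)
  constructor
  · calc (m : ℝ) ^ 2 / (4 * n) = n * (m / (2 * n)) ^ 2 := by field_simp; norm_num
      _ ≤ n * q ^ 2 := by gcongr
      _ ≤ _ := by nlinarith
  · calc 2 * q + ((n : ℝ) - 2) * q ^ 2 ≤ 2 * ((m : ℝ) / n) + n * ((m : ℝ) / n) ^ 2 := by
          have h3 : (n : ℝ) * q ^ 2 ≤ n * ((m : ℝ) / n) ^ 2 := by gcongr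
          have h4 := sq_nonneg q
          linarith
      _ = (2 * (m : ℝ) + (m : ℝ) ^ 2) / n := by field_simp
      _ ≤ _ := by gcongr; nlinarith

end CommonValues

/-! ### Mean and covariance bounds for given planted sets. -/

section Planted

variable {m n : ℕ}

theorem covariance_plantedLaw_le (hm : 1 ≤ m) (hmn : m ≤ n) {p : unitInterval} (hp0 : 0 < p)
    (hp1 : p < 1) (A₀ B₀ : Finset (Fin n)) (i j : Fin n) :
    covariance (fun G => leftWeight p m G i) (fun G => leftWeight p m G j)
      (plantedLaw n p A₀ B₀) ≤ 4 * momentConst (p : ℝ)⁻¹ m n B₀.card * (meanCommon m i j / n) := by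
  have h0 : (0 : ℝ) < p := hp0
  have h1 : (p : ℝ) < 1 := hp1
  have hL : 1 ≤ (p : ℝ)⁻¹ := (one_lt_inv₀ h0).mpr h1 |>.le
  rw [covariance_leftWeight_plantedLaw hm]
  refine (Finset.expect_le_expect fun c _ => Finset.expect_le_expect fun d _ =>
    covariance_term_le h0 h1 A₀ B₀ c d).trans ?_
  rw [expect_expect_pairsThrough]
  refine (Finset.expect_le_expect fun f₁ _ => Finset.expect_le_expect fun f₂ _ =>
    expect_common_mul_pow_excess_le hL hmn B₀ f₁ f₂).trans (le_of_eq ?_)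
  simp_rw [meanCommon, ← Finset.mul_expect, ← Finset.expect_div]
  ring

theorem le_covariance_plantedLaw (hm : 1 ≤ m) (hmn : m ≤ n) {p : unitInterval} (hp0 : 0 < p)
    (hp1 : p < 1) (A₀ B₀ : Finset (Fin n)) (i j : Fin n) :
    ((p : ℝ)⁻¹ - 1) * ((n - B₀.card) / n) * (meanCommon m i j / n) ≤
    covariance (fun G => leftWeight p m G i) (fun G => leftWeight p m G j)
      (plantedLaw n p A₀ B₀) := by
  have h0 : (0 : ℝ) < p := hp0
  have h1 : (p : ℝ) < 1 := hp1
  rw [covariance_leftWeight_plantedLaw hm]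
  refine le_trans (le_of_eq ?_) (Finset.expect_le_expect fun c _ =>
    Finset.expect_le_expect fun d _ => le_covariance_term h0 h1 A₀ B₀ c d)
  rw [expect_expect_pairsThrough]
  simp_rw [← Finset.mul_expect, expect_sum_common_off hmn, ← Finset.expect_mul]
  rw [meanCommon]
  ring

theorem expect_pow_fixedPoints_le {L : ℝ} (hL : 1 ≤ L) :
    𝔼 π : Equiv.Perm (Fin m), L ^ (∑ k, if k = π k then 1 else 0) ≤ Real.exp (L - 1) := by
  have h := expect_perm_pow_sum_le hL (fun k v : Fin m => if k = v then 1 else 0) (d := 1) (D := 1)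
    (fun k v => by split_ifs <;> simp) (fun k => by simp)
  simpa using h

theorem agreements_comp_perm (g : Fin m ↪ Fin n) (π : Equiv.Perm (Fin m)) :
    agreements g (g ∘ π) = ∑ k, if k = π k then 1 else 0 := by
  simp [agreements]

theorem one_le_integral_leftWeight (hm : 1 ≤ m) (hmn : m ≤ n) {p : unitInterval}
    (hp0 : 0 < p) (hp1 : p < 1) (A₀ B₀ : Finset (Fin n)) (i : Fin n) :
    1 ≤ ∫ G, leftWeight p m G i ∂(plantedLaw n p A₀ B₀) := by
  have h0 : (0 : ℝ) < p := hp0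
  have h1 : (p : ℝ) < 1 := hp1
  have hne : (pairsThrough m i).Nonempty := by
    have : Nonempty (Fin m ↪ Fin n) := ⟨Fin.castLEEmb hmn⟩
    exact (embeddingsThrough_nonempty hm hmn i).product
      (Finset.univ_nonempty.product Finset.univ_nonempty)
  rw [integral_leftWeight_plantedLaw hm]
  refine Finset.le_expect hne fun c _ => ?_
  rw [one_le_div (by positivity)]
  exact pow_le_pow_of_le_one h0.le h1.le
    (le_of_add_le_left (card_edges_sdiff_add_agreements_le c (A₀ ×ˢ B₀)))

theorem edges_weight_le {p : ℝ} (hp0 : 0 < p) (hp1 : p < 1) (A₀ B₀ : Finset (Fin n))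
    (f g : Fin m ↪ Fin n) (π : Equiv.Perm (Fin m)) :
    p ^ (MatchingPair.edges (f, g, π) \ (A₀ ×ˢ B₀)).card / p ^ (2 * m) ≤
      p⁻¹ ^ (2 * hits B₀ g) * p⁻¹ ^ (∑ k, if k = π k then 1 else 0) := by
  have h := two_mul_le_card_edges_sdiff_add (f, g, π) A₀ B₀
  simp only [hits_comp_perm, ← two_mul] at h
  rw [← agreements_comp_perm g, div_le_iff₀ (by positivity), ← pow_add, inv_pow, inv_mul_eq_div,
    le_div_iff₀ (by positivity), ← pow_add]
  exact pow_le_pow_of_le_one hp0.le hp1.le (by omega)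

theorem integral_leftWeight_le (hm : 1 ≤ m) (hmn : m ≤ n) {p : unitInterval}
    (hp0 : 0 < p) (hp1 : p < 1) (A₀ B₀ : Finset (Fin n)) (i : Fin n) :
    ∫ G, leftWeight p m G i ∂(plantedLaw n p A₀ B₀) ≤
      Real.exp (((p : ℝ)⁻¹ ^ 2 - 1) * (2 * B₀.card : ℕ) * m / n) * Real.exp ((p : ℝ)⁻¹ - 1) := by
  have h0 : (0 : ℝ) < p := hp0
  have h1 : (p : ℝ) < 1 := hp1
  have hL : 1 ≤ (p : ℝ)⁻¹ := (one_lt_inv₀ h0).mpr h1 |>.le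
  rw [integral_leftWeight_plantedLaw hm, expect_pairsThrough]
  refine Finset.expect_le (embeddingsThrough_nonempty hm hmn i) fun f _ => ?_
  refine (Finset.expect_le_expect fun g _ => Finset.expect_le_expect fun π _ =>
    edges_weight_le h0 h1 A₀ B₀ f g π).trans ?_
  rw [← Finset.expect_mul_expect]
  exact mul_le_mul (expect_pow_hits_le hL hmn B₀) (expect_pow_fixedPoints_le hL)
    (Finset.expect_nonneg fun _ _ => by positivity) (Real.exp_pos _).le

end Planted

/-! ### Dependence of the mean on the planted sets. -/

section Relabel

variable {m n : ℕ}

theorem edges_relabel (ρ ρ' : Equiv.Perm (Fin n)) (f g : Fin m ↪ Fin n) (π : Equiv.Perm (Fin m)) :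
    MatchingPair.edges ((Equiv.refl _).embeddingCongr ρ f, (Equiv.refl _).embeddingCongr ρ' g, π) =
      (MatchingPair.edges (f, g, π)).map (ρ.prodCongr ρ').toEmbedding := by
  rw [MatchingPair.edges, MatchingPair.edges, Finset.map_union]
  simp only [pairEdges, Finset.map_eq_image, Finset.image_image]
  rfl

theorem integral_leftWeight_relabel (hm : 1 ≤ m) (p : unitInterval) (A₀ B₀ : Finset (Fin n))
    (ρ ρ' : Equiv.Perm (Fin n)) (i : Fin n) :
    ∫ G, leftWeight p m G i ∂(plantedLaw n p A₀ B₀) =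
      ∫ G, leftWeight p m G (ρ i)
        ∂(plantedLaw n p (A₀.map ρ.toEmbedding) (B₀.map ρ'.toEmbedding)) := by
  rw [integral_leftWeight_plantedLaw hm, integral_leftWeight_plantedLaw hm]
  refine Finset.expect_equiv (((Equiv.refl _).embeddingCongr ρ).prodCongr
    (((Equiv.refl _).embeddingCongr ρ').prodCongr (Equiv.refl _))) ?_ ?_
  · rintro ⟨f, g, π⟩
    simp only [pairsThrough, embeddingsThrough, Equiv.prodCongr_apply, Prod.map_apply,
      Finset.mem_product, Finset.mem_filter, Finset.mem_univ, true_and, and_true]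
    rw [mem_map_embeddingCongr, Equiv.symm_apply_apply]
  · rintro ⟨f, g, π⟩ _
    simp only [Equiv.prodCongr_apply, Prod.map_apply, Equiv.refl_apply]
    rw [edges_relabel]
    have : (A₀.map ρ.toEmbedding) ×ˢ (B₀.map ρ'.toEmbedding) =
        (A₀ ×ˢ B₀).map (ρ.prodCongr ρ').toEmbedding := by
      ext ⟨u, v⟩
      simp [Finset.mem_map_equiv]
    rw [this, ← Finset.map_sdiff, Finset.card_map]

theorem exists_perm_map_eq {A A' : Finset (Fin n)} (h : A.card = A'.card) :
    ∃ ρ : Equiv.Perm (Fin n), A.map ρ.toEmbedding = A' := by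
  have e : {x // x ∈ A} ≃ {x // x ∈ A'} := Fintype.equivOfCardEq (by simpa using h)
  refine ⟨e.extendSubtype, ?_⟩
  refine Finset.eq_of_subset_of_card_le (fun x hx => ?_) (by rw [Finset.card_map, h])
  obtain ⟨y, hy, rfl⟩ := Finset.mem_map.mp hx
  exact e.extendSubtype_mem y hy

/-- Any permutation carrying `A` to `A'` can be corrected by the transposition of `ρ i` and `i'`:
these points are both in `A'` or both outside, so `A'` is preserved. -/
theorem exists_perm_map_eq_apply_eq {A A' : Finset (Fin n)} (h : A.card = A'.card) {i i' : Fin n}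
    (hi : i ∈ A ↔ i' ∈ A') :
    ∃ ρ : Equiv.Perm (Fin n), A.map ρ.toEmbedding = A' ∧ ρ i = i' := by
  obtain ⟨ρ, hρ⟩ := exists_perm_map_eq h
  have hmem : ρ i ∈ A' ↔ i' ∈ A' := by
    rw [← hi, ← hρ, Finset.mem_map_equiv, Equiv.symm_apply_apply]
  refine ⟨ρ.trans (Equiv.swap (ρ i) i'), ?_, by simp⟩
  ext x
  rw [Finset.mem_map_equiv]
  simp only [Equiv.symm_trans_apply, Equiv.symm_swap]
  rw [← Finset.mem_map_equiv, hρ]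
  rcases eq_or_ne x (ρ i) with rfl | h1
  · rw [Equiv.swap_apply_left]; exact hmem.symm
  rcases eq_or_ne x i' with rfl | h2
  · rw [Equiv.swap_apply_right]; exact hmem
  · rw [Equiv.swap_apply_of_ne_of_ne h1 h2]

theorem integral_leftWeight_eq_of_mem_iff (hm : 1 ≤ m) (p : unitInterval)
    {A A' B B' : Finset (Fin n)} (hA : A.card = A'.card) (hB : B.card = B'.card) {i i' : Fin n}
    (hi : i ∈ A ↔ i' ∈ A') :
    ∫ G, leftWeight p m G i ∂(plantedLaw n p A B) =
      ∫ G, leftWeight p m G i' ∂(plantedLaw n p A' B') := by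
  obtain ⟨ρ, hρ, hρi⟩ := exists_perm_map_eq_apply_eq hA hi
  obtain ⟨ρ', hρ'⟩ := exists_perm_map_eq hB
  rw [integral_leftWeight_relabel hm p A B ρ ρ' i, hρ, hρ', hρi]

end Relabel

/-! ### Effect of deleting one planted vertex. -/

section Removal

variable {m n : ℕ}

/-- Unplanting `u` matters only if a matching edge at `u` ends in `B₀`; in that case the difference
is bounded by the whole weight. -/
theorem edges_weight_sub_le {p : ℝ} (hp0 : 0 < p) (hp1 : p < 1) (A₀ B₀ : Finset (Fin n))
    (u : Fin n) (f g : Fin m ↪ Fin n) (π : Equiv.Perm (Fin m)) :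
    p ^ (MatchingPair.edges (f, g, π) \ (A₀ ×ˢ B₀)).card / p ^ (2 * m) -
      p ^ (MatchingPair.edges (f, g, π) \ ((A₀.erase u) ×ˢ B₀)).card / p ^ (2 * m) ≤
    ∑ k, if f k = u then ((if g k ∈ B₀ then 1 else 0) + (if g (π k) ∈ B₀ then 1 else 0)) *
      (p⁻¹ ^ (2 * hits B₀ g) * p⁻¹ ^ (∑ k, if k = π k then 1 else 0)) else 0 := by
  have hw := edges_weight_le hp0 hp1 A₀ B₀ f g π
  set Z := p⁻¹ ^ (2 * hits B₀ g) * p⁻¹ ^ (∑ k, if k = π k then 1 else 0)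
  have hZ : 0 ≤ Z := by positivity
  have hterm : ∀ k, 0 ≤ (if f k = u then ((if g k ∈ B₀ then (1 : ℝ) else 0) +
      (if g (π k) ∈ B₀ then 1 else 0)) * Z else 0) := by
    intro k
    split_ifs <;> simp [hZ]
  by_cases h : ∃ k, f k = u ∧ (g k ∈ B₀ ∨ g (π k) ∈ B₀)
  · obtain ⟨k, hk, hB⟩ := h
    have h1 : 0 ≤ p ^ (MatchingPair.edges (f, g, π) \ ((A₀.erase u) ×ˢ B₀)).card / p ^ (2 * m) := by
      positivity
    refine le_trans ?_ (Finset.single_le_sum (fun k _ => hterm k) (Finset.mem_univ k))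
    rw [if_pos hk]
    have h2 : (1 : ℝ) ≤ (if g k ∈ B₀ then (1 : ℝ) else 0) + (if g (π k) ∈ B₀ then 1 else 0) := by
      rcases hB with hB | hB <;> simp only [hB, if_true] <;> split_ifs <;> norm_num
    nlinarith
  · have hS : MatchingPair.edges (f, g, π) \ (A₀ ×ˢ B₀) =
        MatchingPair.edges (f, g, π) \ ((A₀.erase u) ×ˢ B₀) := by
      ext e
      simp only [Finset.mem_sdiff, Finset.mem_product, Finset.mem_erase]
      refine and_congr_right fun he => ?_
      have : e.2 ∈ B₀ → e.1 ≠ u := by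
        rintro h2 rfl
        simp only [MatchingPair.edges, pairEdges, Finset.mem_union, Finset.mem_image,
          Finset.mem_univ, true_and] at he
        rcases he with ⟨k, rfl⟩ | ⟨k, rfl⟩
        · exact h ⟨k, rfl, Or.inl h2⟩
        · exact h ⟨k, rfl, Or.inr h2⟩
      tauto
    rw [hS, sub_self]
    exact Finset.sum_nonneg fun k _ => hterm k

theorem expect_mem_mul_pow_hits_le {L : ℝ} (hL : 1 ≤ L) (hmn : m ≤ n) (B : Finset (Fin n))
    (k : Fin m) :
    𝔼 g : Fin m ↪ Fin n, (if g k ∈ B then 1 else 0) * L ^ (2 * hits B g) ≤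
      B.card * ((1 + (L ^ 2 - 1) * 2) / n *
        Real.exp ((L ^ 2 - 1) * (2 * B.card : ℕ) * m / n)) := by
  have h := fun v => expect_embedding_ite_mul_pow_sum_le (α := Fin m) (β := Fin n)
    (by simpa using hmn) hL (fun k v => 2 * if v ∈ B then 1 else 0) (d := 2) (D := 2 * B.card)
    ?_ ?_ k v
  · simp only [← Finset.mul_sum, Fintype.card_fin] at h
    calc 𝔼 g : Fin m ↪ Fin n, (if g k ∈ B then 1 else 0) * L ^ (2 * hits B g)
        = ∑ v ∈ B, 𝔼 g : Fin m ↪ Fin n, (if g k = v then 1 else 0) * L ^ (2 * hits B g) := by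
          rw [← Finset.expect_sum_comm]
          refine Finset.expect_congr rfl fun g _ => ?_
          rw [← Finset.sum_mul, Finset.sum_ite_eq]
      _ ≤ ∑ v ∈ B, ((1 + (L ^ 2 - 1) * 2) / n *
            Real.exp ((L ^ 2 - 1) * (2 * B.card : ℕ) * m / n)) :=
          Finset.sum_le_sum fun v _ => by exact_mod_cast h v
      _ = _ := by rw [Finset.sum_const, nsmul_eq_mul]
  · intro k v; split_ifs <;> simp
  · intro k; simp [mul_comm]

theorem integral_leftWeight_erase_le (hm : 1 ≤ m) {p : unitInterval} (hp0 : 0 < p) (hp1 : p < 1)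
    (A₀ B₀ : Finset (Fin n)) (u i : Fin n) :
    ∫ G, leftWeight p m G i ∂(plantedLaw n p (A₀.erase u) B₀) ≤
      ∫ G, leftWeight p m G i ∂(plantedLaw n p A₀ B₀) := by
  have h0 : (0 : ℝ) < p := hp0
  have h1 : (p : ℝ) < 1 := hp1
  rw [integral_leftWeight_plantedLaw hm, integral_leftWeight_plantedLaw hm]
  refine Finset.expect_le_expect fun c _ => ?_
  gcongr ?_ / _
  refine pow_le_pow_of_le_one h0.le h1.le (Finset.card_le_card ?_)
  gcongr
  exact Finset.erase_subset _ _

/-- At most one index `k` has `f k = u`, and it carries two matching edges. Each of them ends in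
`B₀` with weighted probability `O(K/n)`, which explains the factor 2. -/
theorem integral_leftWeight_le_erase_add (hm : 1 ≤ m) (hmn : m ≤ n) {p : unitInterval}
    (hp0 : 0 < p) (hp1 : p < 1) (A₀ B₀ : Finset (Fin n)) (u i : Fin n) :
    ∫ G, leftWeight p m G i ∂(plantedLaw n p A₀ B₀) ≤
      ∫ G, leftWeight p m G i ∂(plantedLaw n p (A₀.erase u) B₀) +
      2 * (B₀.card * ((1 + ((p : ℝ)⁻¹ ^ 2 - 1) * 2) / n *
        Real.exp (((p : ℝ)⁻¹ ^ 2 - 1) * (2 * B₀.card : ℕ) * m / n)) * Real.exp ((p : ℝ)⁻¹ - 1)) := by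
  have h0 : (0 : ℝ) < p := hp0
  have h1 : (p : ℝ) < 1 := hp1
  have hL : 1 ≤ (p : ℝ)⁻¹ := (one_lt_inv₀ h0).mpr h1 |>.le
  set L : ℝ := (p : ℝ)⁻¹ with hLdef
  have hx : 0 ≤ L ^ 2 - 1 := by have := one_le_pow₀ hL (n := 2); linarith
  set δ : ℝ := B₀.card * ((1 + (L ^ 2 - 1) * 2) / n *
        Real.exp ((L ^ 2 - 1) * (2 * B₀.card : ℕ) * m / n)) * Real.exp (L - 1)
  have hδ : 0 ≤ δ := by positivity
  rw [← sub_le_iff_le_add', integral_leftWeight_plantedLaw hm, integral_leftWeight_plantedLaw hm,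
    ← Finset.expect_sub_distrib, expect_pairsThrough]
  refine Finset.expect_le (embeddingsThrough_nonempty hm hmn i) fun f _ => ?_
  refine (Finset.expect_le_expect fun g _ => Finset.expect_le_expect fun π _ =>
    edges_weight_sub_le h0 h1 A₀ B₀ u f g π).trans ?_
  have key : ∀ k, 𝔼 g : Fin m ↪ Fin n, 𝔼 π : Equiv.Perm (Fin m), (if g k ∈ B₀ then 1 else 0) *
      (L ^ (2 * hits B₀ g) * L ^ (∑ k, if k = π k then 1 else 0)) ≤ δ := by
    intro k
    simp_rw [← mul_assoc]
    rw [← Finset.expect_mul_expect]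
    exact mul_le_mul (expect_mem_mul_pow_hits_le hL hmn B₀ k) (expect_pow_fixedPoints_le hL)
      (Finset.expect_nonneg fun _ _ => by positivity) (by positivity)
  -- The second matching reduces to the first by exchanging the two.
  have key' : ∀ k, 𝔼 g : Fin m ↪ Fin n, 𝔼 π : Equiv.Perm (Fin m),
      (if g (π k) ∈ B₀ then 1 else 0) *
      (L ^ (2 * hits B₀ g) * L ^ (∑ k, if k = π k then 1 else 0)) ≤ δ := by
    intro k
    refine le_of_eq_of_le ?_ (key k)
    have h := expect_swap_matchings fun a b : Fin m → Fin n => (if b k ∈ B₀ then 1 else 0) *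
      (L ^ (hits B₀ a + hits B₀ b) * L ^ agreements a b)
    simpa only [hits_comp_perm, ← two_mul, agreements_comm (_ ∘ _), agreements_comp_perm,
      Function.comp_apply] using h
  calc _ = ∑ k, if f k = u then (𝔼 g : Fin m ↪ Fin n, 𝔼 π : Equiv.Perm (Fin m),
          (if g k ∈ B₀ then 1 else 0) *
          (L ^ (2 * hits B₀ g) * L ^ (∑ k, if k = π k then 1 else 0))) +
          (𝔼 g : Fin m ↪ Fin n, 𝔼 π : Equiv.Perm (Fin m), (if g (π k) ∈ B₀ then 1 else 0) *
          (L ^ (2 * hits B₀ g) * L ^ (∑ k, if k = π k then 1 else 0))) else 0 := by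
        simp_rw [Finset.expect_sum_comm]
        refine Finset.sum_congr rfl fun k _ => ?_
        split_ifs
        · simp only [add_mul, Finset.expect_add_distrib, hLdef]
        · simp
    _ ≤ ∑ k, if f k = u then 2 * δ else 0 := by
        refine Finset.sum_le_sum fun k _ => ?_
        split_ifs
        · have := key k
          have := key' k
          linarith
        · exact le_rfl
    _ = (∑ k, if f k = u then 1 else 0 : ℕ) * (2 * δ) := by
        push_cast
        rw [Finset.sum_mul]
        simp only [ite_mul, one_mul, zero_mul]
    _ ≤ 1 * (2 * δ) := by
        gcongr
        exact_mod_cast sum_ite_le_one (fun k => f k = u)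
          fun x y hx hy => f.injective (hx.trans hy.symm)
    _ = _ := one_mul _

end Removal

/-! ### Uniformly random planted sets. -/

section Mixture

variable {n K : ℕ}

theorem powersetCard_univ_nonempty (hK : K ≤ n) :
    ((Finset.univ : Finset (Fin n)).powersetCard K).Nonempty :=
  Finset.powersetCard_nonempty.mpr (by simpa using hK)

theorem integral_randomPlantedLaw (hK : K ≤ n) (p : unitInterval) (F : BipGraph n → ℝ) :
    ∫ G, F G ∂(randomPlantedLaw n p K) =
      𝔼 A ∈ (Finset.univ : Finset (Fin n)).powersetCard K,
        𝔼 B ∈ (Finset.univ : Finset (Fin n)).powersetCard K, ∫ G, F G ∂(plantedLaw n p A B) := by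
  have hc : (n.choose K : ℝ≥0∞)⁻¹ * (n.choose K : ℝ≥0∞)⁻¹ ≠ ∞ := by
    have h : (n.choose K : ℝ≥0∞) ≠ 0 := by exact_mod_cast (Nat.choose_pos hK).ne'
    exact ENNReal.mul_ne_top (ENNReal.inv_ne_top.mpr h) (ENNReal.inv_ne_top.mpr h)
  have hint : ∀ A B : Finset (Fin n), Integrable F
      (((n.choose K : ℝ≥0∞)⁻¹ * (n.choose K : ℝ≥0∞)⁻¹) • plantedLaw n p A B) := fun A B =>
    Integrable.of_finite.smul_measure hc
  rw [randomPlantedLaw, integral_finsetSum_measure fun A _ =>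
    integrable_finsetSum_measure.mpr fun B _ => hint A B]
  simp only [Finset.expect_eq_sum_div_card, Finset.card_powersetCard, Finset.card_univ,
    Fintype.card_fin, Finset.sum_div]
  refine Finset.sum_congr rfl fun A _ => ?_
  rw [integral_finsetSum_measure fun B _ => hint A B]
  refine Finset.sum_congr rfl fun B _ => ?_
  rw [integral_smul_measure, smul_eq_mul, ENNReal.toReal_mul, ENNReal.toReal_inv,
    ENNReal.toReal_natCast]
  ring

theorem isProbabilityMeasure_randomPlantedLaw (hK : K ≤ n) (p : unitInterval) :
    IsProbabilityMeasure (randomPlantedLaw n p K) := by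
  have h : (n.choose K : ℝ≥0∞) ≠ 0 := by
    exact_mod_cast (Nat.choose_pos hK).ne'
  constructor
  simp only [randomPlantedLaw, Measure.coe_finsetSum, Finset.sum_apply, Measure.smul_apply,
    measure_univ, smul_eq_mul, mul_one, Finset.sum_const, Finset.card_powersetCard,
    Finset.card_univ, Fintype.card_fin, nsmul_eq_mul]
  rw [← mul_assoc, mul_mul_mul_comm, ENNReal.mul_inv_cancel h (by simp), one_mul]

theorem expect_mem_powersetCard (hK : K ≤ n) (i : Fin n) :
    𝔼 A ∈ (Finset.univ : Finset (Fin n)).powersetCard K, (if i ∈ A then (1 : ℝ) else 0) =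
      K / n := by
  have hne := powersetCard_univ_nonempty hK
  have hn : (n : ℝ) ≠ 0 := by
    have := i.pos
    positivity
  have hsymm : ∀ w, 𝔼 A ∈ (Finset.univ : Finset (Fin n)).powersetCard K,
      (if w ∈ A then (1 : ℝ) else 0) = 𝔼 A ∈ (Finset.univ : Finset (Fin n)).powersetCard K,
      (if i ∈ A then (1 : ℝ) else 0) := by
    intro w
    refine Finset.expect_equiv (Equiv.swap w i).finsetCongr ?_ ?_
    · intro A; simp [Finset.mem_powersetCard]
    · intro A _
      simp [Finset.mem_map_equiv]
  have hsum : ∑ w, 𝔼 A ∈ (Finset.univ : Finset (Fin n)).powersetCard K,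
      (if w ∈ A then (1 : ℝ) else 0) = K := by
    rw [← Finset.expect_sum_comm, Finset.expect_congr rfl (g := fun _ => (K : ℝ)),
      Finset.expect_const hne]
    intro A hA
    rw [Finset.sum_ite_mem, Finset.univ_inter, Finset.sum_const,
      (Finset.mem_powersetCard.mp hA).2]
    simp
  simp_rw [hsymm] at hsum
  rw [Finset.sum_const, Finset.card_univ, Fintype.card_fin, nsmul_eq_mul] at hsum
  rw [eq_div_iff hn]
  linarith

theorem expect_mem_mul_mem_powersetCard (hK : K ≤ n) {i j : Fin n} (hij : i ≠ j) :
    ((n : ℝ) - 1) * 𝔼 A ∈ (Finset.univ : Finset (Fin n)).powersetCard K,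
      ((if i ∈ A then (1 : ℝ) else 0) * if j ∈ A then (1 : ℝ) else 0) =
      (K - 1) * (K / n) := by
  have hsymm : ∀ w ∈ Finset.univ.erase i, 𝔼 A ∈ (Finset.univ : Finset (Fin n)).powersetCard K,
      ((if i ∈ A then (1 : ℝ) else 0) * if w ∈ A then (1 : ℝ) else 0) =
      𝔼 A ∈ (Finset.univ : Finset (Fin n)).powersetCard K,
      ((if i ∈ A then (1 : ℝ) else 0) * if j ∈ A then (1 : ℝ) else 0) := by
    intro w hw
    have hw : w ≠ i := (Finset.mem_erase.mp hw).1
    refine Finset.expect_equiv (Equiv.swap w j).finsetCongr ?_ ?_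
    · intro A; simp [Finset.mem_powersetCard]
    · intro A _
      simp only [Equiv.finsetCongr_apply, Finset.mem_map_equiv, Equiv.symm_swap,
        Equiv.swap_apply_right, Equiv.swap_apply_of_ne_of_ne hw.symm hij]
  have hsum : ∑ w, 𝔼 A ∈ (Finset.univ : Finset (Fin n)).powersetCard K,
      ((if i ∈ A then (1 : ℝ) else 0) * if w ∈ A then (1 : ℝ) else 0) = K * (K / n) := by
    rw [← Finset.expect_sum_comm, ← expect_mem_powersetCard hK i, Finset.mul_expect]
    refine Finset.expect_congr rfl fun A hA => ?_
    rw [← Finset.mul_sum, Finset.sum_ite_mem, Finset.univ_inter, Finset.sum_const,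
      (Finset.mem_powersetCard.mp hA).2]
    simp [mul_comm]
  rw [← Finset.add_sum_erase _ _ (Finset.mem_univ i), Finset.sum_congr rfl hsymm,
    Finset.sum_const, Finset.card_erase_of_mem (Finset.mem_univ i), Finset.card_univ,
    Fintype.card_fin, nsmul_eq_mul, Nat.cast_sub i.pos] at hsum
  simp only [← ite_and, mul_ite, mul_one, mul_zero, and_self] at hsum ⊢
  rw [expect_mem_powersetCard hK] at hsum
  push_cast at hsum
  linarith

/-- The covariance of the indicators of `i` and `j` under a uniform `K`-subset. -/
noncomputable def membershipCov (K : ℕ) {n : ℕ} (i j : Fin n) : ℝ :=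
  𝔼 A ∈ (Finset.univ : Finset (Fin n)).powersetCard K,
      ((if i ∈ A then (1 : ℝ) else 0) * if j ∈ A then (1 : ℝ) else 0) - (K / n) * (K / n)

theorem abs_membershipCov_self_le (hK : K ≤ n) (i : Fin n) :
    |membershipCov K i i| ≤ K / n := by
  have hn : (0 : ℝ) < n := by exact_mod_cast i.pos
  have h1 : (K : ℝ) / n ≤ 1 := (div_le_one hn).mpr (by exact_mod_cast hK)
  have h2 : (0 : ℝ) ≤ (K : ℝ) / n := by positivity
  rw [membershipCov]
  simp only [← ite_and, mul_ite, mul_one, mul_zero, and_self]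
  rw [expect_mem_powersetCard hK, abs_le]
  constructor <;> nlinarith

/-- The covariance is exactly `-K(n - K)/(n²(n - 1))`. Being negative, it has to be absorbed in the
lower bound for the weights. -/
theorem abs_membershipCov_le_of_ne (hK : K ≤ n) {i j : Fin n} (hij : i ≠ j) :
    |membershipCov K i j| ≤ K / n / n := by
  have hn : 1 < n := by
    by_contra h
    exact hij (Fin.ext (by omega))
  have hn' : (1 : ℝ) < n := by exact_mod_cast hn
  have hn1 : (0 : ℝ) < (n : ℝ) - 1 := by linarith
  have hK' : (K : ℝ) ≤ n := by exact_mod_cast hK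
  have h := expect_mem_mul_mem_powersetCard hK hij
  rw [mul_comm, ← eq_div_iff hn1.ne'] at h
  rw [membershipCov, h]
  have e : ((K : ℝ) - 1) * (K / n) / (n - 1) - K / n * (K / n) =
      -(K * (n - K) / (n * n * (n - 1))) := by
    field_simp
    ring
  rw [e, abs_neg, abs_of_nonneg (by
    apply div_nonneg <;> [exact mul_nonneg (by positivity) (by linarith); positivity])]
  rw [div_div, div_le_div_iff₀ (by positivity) (by positivity)]
  rcases Nat.eq_zero_or_pos K with rfl | hK0
  · simp
  · have : (1 : ℝ) ≤ K := by exact_mod_cast hK0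
    have h3 : (K : ℝ) * (n * n) * (n - K) ≤ K * (n * n) * (n - 1) := by gcongr
    linarith

/-- The law of total covariance, for conditional means that depend on the planted sets only through
one membership indicator. -/
theorem covariance_randomPlantedLaw (hK : K ≤ n) (p : unitInterval) (X Y : BipGraph n → ℝ)
    (i j : Fin n) (a b : ℝ)
    (hX : ∀ A B : Finset (Fin n), A.card = K → B.card = K →
      ∫ G, X G ∂(plantedLaw n p A B) = a + b * if i ∈ A then 1 else 0)
    (hY : ∀ A B : Finset (Fin n), A.card = K → B.card = K →
      ∫ G, Y G ∂(plantedLaw n p A B) = a + b * if j ∈ A then 1 else 0) :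
    covariance X Y (randomPlantedLaw n p K) =
      𝔼 A ∈ (Finset.univ : Finset (Fin n)).powersetCard K,
        𝔼 B ∈ (Finset.univ : Finset (Fin n)).powersetCard K, covariance X Y (plantedLaw n p A B) +
      b ^ 2 * membershipCov K i j := by
  have := isProbabilityMeasure_randomPlantedLaw hK p
  have hne := powersetCard_univ_nonempty hK
  have hmean : ∀ (Z : BipGraph n → ℝ) (u : Fin n), (∀ A B : Finset (Fin n), A.card = K →
      B.card = K → ∫ G, Z G ∂(plantedLaw n p A B) = a + b * if u ∈ A then 1 else 0) →
      ∫ G, Z G ∂(randomPlantedLaw n p K) = a + b * (K / n) := by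
    intro Z u hZ
    rw [integral_randomPlantedLaw hK, ← expect_mem_powersetCard hK u, Finset.mul_expect]
    conv_rhs => rw [← Finset.expect_const hne a]
    rw [← Finset.expect_add_distrib]
    refine Finset.expect_congr rfl fun A hA => ?_
    rw [Finset.expect_congr rfl fun B hB => hZ A B (Finset.mem_powersetCard.mp hA).2
      (Finset.mem_powersetCard.mp hB).2, Finset.expect_const hne]
  have hcov : 𝔼 A ∈ (Finset.univ : Finset (Fin n)).powersetCard K,
      𝔼 B ∈ (Finset.univ : Finset (Fin n)).powersetCard K, covariance X Y (plantedLaw n p A B) =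
      ∫ G, X G * Y G ∂(randomPlantedLaw n p K) -
        𝔼 A ∈ (Finset.univ : Finset (Fin n)).powersetCard K,
        (a + b * if i ∈ A then 1 else 0) * (a + b * if j ∈ A then 1 else 0) := by
    rw [integral_randomPlantedLaw hK, ← Finset.expect_sub_distrib]
    refine Finset.expect_congr rfl fun A hA => ?_
    conv_rhs => rw [← Finset.expect_const hne
      ((a + b * if i ∈ A then (1 : ℝ) else 0) * (a + b * if j ∈ A then 1 else 0))]
    rw [← Finset.expect_sub_distrib]
    refine Finset.expect_congr rfl fun B hB => ?_
    rw [covariance_eq_integral_sub, hX A B (Finset.mem_powersetCard.mp hA).2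
      (Finset.mem_powersetCard.mp hB).2, hY A B (Finset.mem_powersetCard.mp hA).2
      (Finset.mem_powersetCard.mp hB).2]
  have hprod : 𝔼 A ∈ (Finset.univ : Finset (Fin n)).powersetCard K,
        (a + b * if i ∈ A then (1 : ℝ) else 0) * (a + b * if j ∈ A then 1 else 0) =
      a ^ 2 + 2 * a * b * (K / n) + b ^ 2 * 𝔼 A ∈ (Finset.univ : Finset (Fin n)).powersetCard K,
      ((if i ∈ A then (1 : ℝ) else 0) * if j ∈ A then (1 : ℝ) else 0) := by
    calc _ = 𝔼 A ∈ (Finset.univ : Finset (Fin n)).powersetCard K,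
          (a ^ 2 + a * b * (if i ∈ A then (1 : ℝ) else 0) +
            a * b * (if j ∈ A then (1 : ℝ) else 0) +
            b ^ 2 * ((if i ∈ A then (1 : ℝ) else 0) * if j ∈ A then (1 : ℝ) else 0)) :=
          Finset.expect_congr rfl fun A _ => by ring
      _ = _ := by
          simp only [Finset.expect_add_distrib, ← Finset.mul_expect, Finset.expect_const hne]
          rw [expect_mem_powersetCard hK, expect_mem_powersetCard hK]
          ring
  rw [covariance_eq_integral_sub, hmean X i hX, hmean Y j hY, hcov, hprod, membershipCov]
  ring

end Mixture

/-! ### Exchange of the two sides. -/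

section Swap

variable {n : ℕ}

theorem map_swapSides_erLaw (p : unitInterval) : (erLaw n p).map swapSides = erLaw n p := by
  refine Measure.ext_of_singleton fun G => ?_
  have h : swapSides ⁻¹' {G} = {swapSides G} := by
    ext G'
    simp only [Set.mem_preimage, Set.mem_singleton_iff]
    exact ⟨fun h => h ▸ rfl, fun h => h ▸ rfl⟩
  rw [Measure.map_apply Measurable.of_discrete (measurableSet_singleton G), h, erLaw,
    Measure.pi_singleton, Measure.pi_singleton]
  simp_rw [Measure.pi_singleton]
  rw [Finset.prod_comm]
  rfl

theorem map_swapSides_plantedLaw (p : unitInterval) (A₀ B₀ : Finset (Fin n)) :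
    (plantedLaw n p A₀ B₀).map swapSides = plantedLaw n p B₀ A₀ := by
  rw [plantedLaw, plantedLaw, Measure.map_map Measurable.of_discrete Measurable.of_discrete]
  conv_rhs => rw [← map_swapSides_erLaw p,
    Measure.map_map Measurable.of_discrete Measurable.of_discrete]
  congr 1
  funext G u v
  simp only [Function.comp_apply, swapSides, plantBiclique, and_comm]

theorem map_swapSides_randomPlantedLaw (p : unitInterval) (K : ℕ) :
    (randomPlantedLaw n p K).map swapSides = randomPlantedLaw n p K := by
  simp only [randomPlantedLaw, ← Measure.mapₗ_apply_of_measurable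
    (Measurable.of_discrete (f := (swapSides : BipGraph n → BipGraph n))), map_sum, map_smul]
  simp only [Measure.mapₗ_apply_of_measurable
    (Measurable.of_discrete (f := (swapSides : BipGraph n → BipGraph n))),
    map_swapSides_plantedLaw]
  rw [Finset.sum_comm]

end Swap

/-! ### Constants independent of `n`. -/

section Constants

/-- Upper bound for the mean weight. -/
noncomputable def meanBound (L D : ℝ) : ℝ := Real.exp ((L ^ 2 - 1) * (2 * D)) * Real.exp (L - 1)

/-- Upper bound for `momentConst`. -/
noncomputable def momentBound (L D : ℝ) : ℝ :=
  Real.exp ((L ^ 3 - 1) * 3) ^ 2 * (1 + (L ^ 3 - 1) * 3) *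
    Real.exp ((L ^ 3 - 1) * (1 + 2 * D)) * Real.exp ((L ^ 2 - 1) * (2 * D))

/-- Bound for the effect of a planted vertex on its mean weight, in units of `K / n`. -/
noncomputable def shiftBound (L D : ℝ) : ℝ :=
  2 * ((1 + (L ^ 2 - 1) * 2) * Real.exp ((L ^ 2 - 1) * (2 * D)) * Real.exp (L - 1))

variable {m n K : ℕ} {L D : ℝ}

theorem exp_card_bound (hL : 1 ≤ L) (hn : 0 < n) (hmK : (m : ℝ) * K ≤ D * n) :
    Real.exp ((L ^ 2 - 1) * (2 * K : ℕ) * m / n) ≤ Real.exp ((L ^ 2 - 1) * (2 * D)) := by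
  have hx : 0 ≤ L ^ 2 - 1 := by have := one_le_pow₀ hL (n := 2); linarith
  have hn' : (0 : ℝ) < n := by exact_mod_cast hn
  rw [Real.exp_le_exp, mul_assoc, mul_div_assoc]
  gcongr
  rw [div_le_iff₀ hn']
  push_cast
  linarith

theorem momentConst_le (hL : 1 ≤ L) (hn : 0 < n) (hmn : m ≤ n) (hmK : (m : ℝ) * K ≤ D * n) :
    momentConst L m n K ≤ momentBound L D := by
  have hx : 0 ≤ L ^ 3 - 1 := by have := one_le_pow₀ hL (n := 3); linarith
  have hn' : (0 : ℝ) < n := by exact_mod_cast hn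
  have hmn' : (m : ℝ) ≤ n := by exact_mod_cast hmn
  rw [momentConst, momentBound]
  have h1 : Real.exp ((L ^ 3 - 1) * (1 + 2 * K : ℕ) * m / n) ≤
      Real.exp ((L ^ 3 - 1) * (1 + 2 * D)) := by
    rw [Real.exp_le_exp, mul_assoc, mul_div_assoc]
    gcongr
    rw [div_le_iff₀ hn']
    push_cast
    linarith
  have h2 := exp_card_bound hL hn hmK
  gcongr

end Constants

/-! ### Uniform bounds for fixed and random planted sets. -/

section Bounds

variable {m n K : ℕ}

/-- By relabelling, the mean takes one value for planted vertices and one for the others; `b` is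
their difference. -/
theorem exists_mean_eq (hm : 1 ≤ m) (hmn : m ≤ n) {p : unitInterval} (hp0 : 0 < p) (hp1 : p < 1)
    (hKn : K < n) {D : ℝ} (hmK : (m : ℝ) * K ≤ D * n) :
    ∃ a b : ℝ, |b| ≤ shiftBound (p : ℝ)⁻¹ D * (K / n) ∧ ∀ (i : Fin n) (A B : Finset (Fin n)),
      A.card = K → B.card = K →
      ∫ G, leftWeight p m G i ∂(plantedLaw n p A B) = a + b * if i ∈ A then 1 else 0 := by
  have h0 : (0 : ℝ) < p := hp0
  have h1 : (p : ℝ) < 1 := hp1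
  have hL : 1 ≤ (p : ℝ)⁻¹ := (one_lt_inv₀ h0).mpr h1 |>.le
  have hn : 0 < n := by omega
  rcases Nat.eq_zero_or_pos K with rfl | hK0
  · refine ⟨∫ G, leftWeight p m G ⟨0, hn⟩ ∂(plantedLaw n p ∅ ∅), 0, by simp, ?_⟩
    intro i A B hA hB
    rw [zero_mul, add_zero]
    rw [Finset.card_eq_zero] at hA hB
    subst hA hB
    exact integral_leftWeight_eq_of_mem_iff hm p rfl rfl (by simp)
  obtain ⟨A₀, -, hA₀⟩ := Finset.exists_subset_card_eq
    (s := (Finset.univ : Finset (Fin n))) (n := K) (by simpa using hKn.le)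
  obtain ⟨u, hu⟩ : A₀.Nonempty := by rw [← Finset.card_pos]; omega
  obtain ⟨w, hw⟩ : ∃ w, w ∉ A₀ := by
    by_contra h
    push Not at h
    have : A₀ = Finset.univ := Finset.eq_univ_iff_forall.mpr h
    rw [this] at hA₀
    simp at hA₀
    omega
  have hwe : w ∉ A₀.erase u := fun h => hw (Finset.mem_of_mem_erase h)
  have huw : u ≠ w := fun h => hw (h ▸ hu)
  -- Trading `u` for `w` gives a set of the same size without `u`. Deleting `u` from `A₀` and `w`
  -- from `A₁` leaves the same set, so both means exceed a common value by at most the deletion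
  -- bound.
  let A₁ := insert w (A₀.erase u)
  have hA₁ : A₁.card = K := by
    rw [Finset.card_insert_of_notMem hwe, Finset.card_erase_of_mem hu, hA₀]; omega
  have hu₁ : u ∉ A₁ := by simp [A₁, huw]
  have herase : A₁.erase w = A₀.erase u := Finset.erase_insert hwe
  let vin := ∫ G, leftWeight p m G u ∂(plantedLaw n p A₀ A₀)
  let vout := ∫ G, leftWeight p m G u ∂(plantedLaw n p A₁ A₀)
  have hδ : 2 * (A₀.card * ((1 + ((p : ℝ)⁻¹ ^ 2 - 1) * 2) / n *
        Real.exp (((p : ℝ)⁻¹ ^ 2 - 1) * (2 * A₀.card : ℕ) * m / n)) * Real.exp ((p : ℝ)⁻¹ - 1)) ≤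
        shiftBound (p : ℝ)⁻¹ D * (K / n) := by
    have hx : 0 ≤ (p : ℝ)⁻¹ ^ 2 - 1 := by have := one_le_pow₀ hL (n := 2); linarith
    rw [hA₀, shiftBound]
    have h2 := exp_card_bound hL hn hmK
    calc _ ≤ 2 * (K * ((1 + ((p : ℝ)⁻¹ ^ 2 - 1) * 2) / n *
        Real.exp (((p : ℝ)⁻¹ ^ 2 - 1) * (2 * D))) * Real.exp ((p : ℝ)⁻¹ - 1)) := by gcongr
      _ = _ := by ring
  have e1 := integral_leftWeight_le_erase_add hm hmn hp0 hp1 A₀ A₀ u u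
  have e2 := integral_leftWeight_erase_le hm hp0 hp1 A₀ A₀ u u
  have e3 := integral_leftWeight_le_erase_add hm hmn hp0 hp1 A₁ A₀ w u
  have e4 := integral_leftWeight_erase_le hm hp0 hp1 A₁ A₀ w u
  rw [herase] at e3 e4
  refine ⟨vout, vin - vout, ?_, ?_⟩
  · rw [abs_le]
    constructor <;> simp only [vin, vout] <;> linarith
  · intro i A B hA hB
    split_ifs with hi
    · rw [mul_one, add_sub_cancel]
      exact integral_leftWeight_eq_of_mem_iff hm p (hA.trans hA₀.symm) (hB.trans hA₀.symm)
        (by simp [hi, hu])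
    · rw [mul_zero, add_zero]
      exact integral_leftWeight_eq_of_mem_iff hm p (hA.trans hA₁.symm) (hB.trans hA₀.symm)
        (by simp [hi, hu₁])

/-- The laws of the graph with planted sets of size `K`, either fixed or uniformly random. -/
def IsPlanted (n : ℕ) (p : unitInterval) (K : ℕ) (μ : Measure (BipGraph n)) : Prop :=
  (∃ A₀ B₀ : Finset (Fin n), A₀.card = K ∧ B₀.card = K ∧ μ = plantedLaw n p A₀ B₀) ∨
    μ = randomPlantedLaw n p K

theorem IsPlanted.map_swapSides {p : unitInterval} {μ : Measure (BipGraph n)}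
    (h : IsPlanted n p K μ) : IsPlanted n p K (μ.map swapSides) := by
  rcases h with ⟨A, B, hA, hB, rfl⟩ | rfl
  · exact Or.inl ⟨B, A, hB, hA, map_swapSides_plantedLaw p A B⟩
  · exact Or.inr (map_swapSides_randomPlantedLaw p K)

theorem mean_leftWeight_bounds (hm : 1 ≤ m) (hmn : m ≤ n) {p : unitInterval} (hp0 : 0 < p)
    (hp1 : p < 1) (hKn : K ≤ n) {D : ℝ} (hmK : (m : ℝ) * K ≤ D * n) {μ : Measure (BipGraph n)}
    (hμ : IsPlanted n p K μ) (i : Fin n) :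
    1 ≤ ∫ G, leftWeight p m G i ∂μ ∧ ∫ G, leftWeight p m G i ∂μ ≤ meanBound (p : ℝ)⁻¹ D := by
  have h0 : (0 : ℝ) < p := hp0
  have h1 : (p : ℝ) < 1 := hp1
  have hL : 1 ≤ (p : ℝ)⁻¹ := (one_lt_inv₀ h0).mpr h1 |>.le
  have key : ∀ A B : Finset (Fin n), B.card = K →
      1 ≤ ∫ G, leftWeight p m G i ∂(plantedLaw n p A B) ∧
        ∫ G, leftWeight p m G i ∂(plantedLaw n p A B) ≤ meanBound (p : ℝ)⁻¹ D := by
    intro A B hB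
    refine ⟨one_le_integral_leftWeight hm hmn hp0 hp1 A B i,
      (integral_leftWeight_le hm hmn hp0 hp1 A B i).trans ?_⟩
    rw [hB, meanBound]
    gcongr ?_ * _
    exact exp_card_bound hL (by omega) hmK
  rcases hμ with ⟨A, B, -, hB, rfl⟩ | rfl
  · exact key A B hB
  · have hne := powersetCard_univ_nonempty hKn
    rw [integral_randomPlantedLaw hKn]
    exact ⟨Finset.le_expect hne fun A _ => Finset.le_expect hne fun B hB =>
        (key A B (Finset.mem_powersetCard.mp hB).2).1,
      Finset.expect_le hne fun A _ => Finset.expect_le hne fun B hB =>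
        (key A B (Finset.mem_powersetCard.mp hB).2).2⟩

theorem covariance_plantedLaw_bounds (hm : 1 ≤ m) (hmn : m ≤ n) {p : unitInterval} (hp0 : 0 < p)
    (hp1 : p < 1) (hKn : 2 * K ≤ n) {D : ℝ} (hmK : (m : ℝ) * K ≤ D * n)
    (A B : Finset (Fin n)) (hB : B.card = K) (i j : Fin n) :
    ((p : ℝ)⁻¹ - 1) / 2 * (meanCommon m i j / n) ≤
      covariance (fun G => leftWeight p m G i) (fun G => leftWeight p m G j) (plantedLaw n p A B) ∧
    covariance (fun G => leftWeight p m G i) (fun G => leftWeight p m G j) (plantedLaw n p A B) ≤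
      4 * momentBound (p : ℝ)⁻¹ D * (meanCommon m i j / n) := by
  have h0 : (0 : ℝ) < p := hp0
  have h1 : (p : ℝ) < 1 := hp1
  have hL : 1 < (p : ℝ)⁻¹ := (one_lt_inv₀ h0).mpr h1
  have hn : (0 : ℝ) < n := by exact_mod_cast i.pos
  have hR : 0 ≤ meanCommon m i j := Finset.expect_nonneg fun _ _ =>
    Finset.expect_nonneg fun _ _ => by positivity
  constructor
  · refine le_trans ?_ (le_covariance_plantedLaw hm hmn hp0 hp1 A B i j)
    rw [hB, div_eq_mul_one_div]
    have h2 : (2 : ℝ) * K ≤ n := by exact_mod_cast hKn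
    have h3 : (1 : ℝ) / 2 ≤ (n - K) / n := by
      rw [div_le_div_iff₀ (by norm_num) hn]; linarith
    have h4 : 0 ≤ (p : ℝ)⁻¹ - 1 := by linarith
    gcongr
  · refine (covariance_plantedLaw_le hm hmn hp0 hp1 A B i j).trans ?_
    rw [hB]
    gcongr
    exact momentConst_le hL.le i.pos hmn hmK

theorem covariance_leftWeight_bounds (hm : 1 ≤ m) (hmn : m ^ 2 ≤ n) {p : unitInterval}
    (hp0 : 0 < p) (hp1 : p < 1) (hKn : 2 * K ≤ n) {D : ℝ} (hmK : (m : ℝ) * K ≤ D * n)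
    (hsmall : shiftBound (p : ℝ)⁻¹ D ^ 2 * K ^ 3 ≤ ((p : ℝ)⁻¹ - 1) / 4 * n ^ 2)
    {μ : Measure (BipGraph n)} (hμ : IsPlanted n p K μ) (i j : Fin n) (hij : i = j ∨ 2 ≤ m) :
    ((p : ℝ)⁻¹ - 1) / 4 * (meanCommon m i j / n) ≤
      covariance (fun G => leftWeight p m G i) (fun G => leftWeight p m G j) μ ∧
    covariance (fun G => leftWeight p m G i) (fun G => leftWeight p m G j) μ ≤
      (4 * momentBound (p : ℝ)⁻¹ D + ((p : ℝ)⁻¹ - 1) / 4) * (meanCommon m i j / n) := by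
  have h0 : (0 : ℝ) < p := hp0
  have h1 : (p : ℝ) < 1 := hp1
  have hL : 1 < (p : ℝ)⁻¹ := (one_lt_inv₀ h0).mpr h1
  have hn0 : 0 < n := i.pos
  have hn : (0 : ℝ) < n := by exact_mod_cast hn0
  have hmn' : m ≤ n := le_trans (by nlinarith) hmn
  have hR : 0 ≤ meanCommon m i j := Finset.expect_nonneg fun _ _ =>
    Finset.expect_nonneg fun _ _ => by positivity
  have hRn : 0 ≤ meanCommon m i j / n := by positivity
  set c := ((p : ℝ)⁻¹ - 1) / 4 with hc
  have hc0 : 0 < c := by rw [hc]; linarith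
  have key := fun A B hB => covariance_plantedLaw_bounds hm hmn' hp0 hp1 hKn hmK A B hB i j
  -- The conditional covariance is at least `2c` times the target order; one `c` is reserved for the
  -- covariance of the conditional means.
  have h2c : ((p : ℝ)⁻¹ - 1) / 2 = 2 * c := by rw [hc]; ring
  simp only [h2c] at key
  rcases hμ with ⟨A, B, -, hB, rfl⟩ | rfl
  · obtain ⟨k1, k2⟩ := key A B hB
    constructor <;> nlinarith
  · have hKn' : K ≤ n := by omega
    have hne := powersetCard_univ_nonempty hKn'
    obtain ⟨a, b, hb, hab⟩ := exists_mean_eq hm hmn' hp0 hp1 (by omega : K < n) hmK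
    rw [covariance_randomPlantedLaw hKn' p _ _ i j a b (hab i) (hab j)]
    have k1 : 2 * c * (meanCommon m i j / n) ≤
        𝔼 A ∈ (Finset.univ : Finset (Fin n)).powersetCard K,
        𝔼 B ∈ (Finset.univ : Finset (Fin n)).powersetCard K,
          covariance (fun G => leftWeight p m G i) (fun G => leftWeight p m G j)
            (plantedLaw n p A B) :=
      Finset.le_expect hne fun A _ => Finset.le_expect hne fun B hB =>
        (key A B (Finset.mem_powersetCard.mp hB).2).1
    have k2 : 𝔼 A ∈ (Finset.univ : Finset (Fin n)).powersetCard K,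
        𝔼 B ∈ (Finset.univ : Finset (Fin n)).powersetCard K,
          covariance (fun G => leftWeight p m G i) (fun G => leftWeight p m G j)
            (plantedLaw n p A B) ≤ 4 * momentBound (p : ℝ)⁻¹ D * (meanCommon m i j / n) :=
      Finset.expect_le hne fun A _ => Finset.expect_le hne fun B hB =>
        (key A B (Finset.mem_powersetCard.mp hB).2).2
    -- On the diagonal `meanCommon ≥ 1`; off it `meanCommon ≥ m²/(4n) ≥ 1/n`, which again needs `m ≥
    -- 2`.
    have k3 : |membershipCov K i j| ≤ K / n * meanCommon m i j := by
      rcases eq_or_ne i j with rfl | hne'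
      · refine (abs_membershipCov_self_le hKn' i).trans (le_mul_of_one_le_right (by positivity) ?_)
        exact (meanCommon_self_bounds hm hmn i).1
      · refine (abs_membershipCov_le_of_ne hKn' hne').trans ?_
        have hm2 : 2 ≤ m := hij.resolve_left hne'
        rw [div_eq_mul_one_div (K / n : ℝ)]
        gcongr
        refine le_trans ?_ (meanCommon_bounds_of_ne hm2 hmn' hne').1
        have : (2 : ℝ) ≤ m := by exact_mod_cast hm2
        have h4 : (4 : ℝ) ≤ (m : ℝ) ^ 2 := by nlinarith
        rw [div_le_div_iff₀ hn (by positivity)]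
        nlinarith
    have k4 : |b ^ 2 * membershipCov K i j| ≤ c * (meanCommon m i j / n) := by
      rw [abs_mul, abs_of_nonneg (sq_nonneg b)]
      have hb2 : b ^ 2 ≤ (shiftBound (p : ℝ)⁻¹ D * (K / n)) ^ 2 := sq_le_sq' (abs_le.mp hb).1
        (abs_le.mp hb).2
      calc b ^ 2 * |membershipCov K i j|
          ≤ (shiftBound (p : ℝ)⁻¹ D * (K / n)) ^ 2 * (K / n * meanCommon m i j) := by gcongr
        _ = (shiftBound (p : ℝ)⁻¹ D ^ 2 * K ^ 3) / n ^ 2 * (meanCommon m i j / n) := by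
            field_simp
        _ ≤ _ := by
            gcongr
            rw [div_le_iff₀ (by positivity)]
            exact hsmall
    obtain ⟨k5, k6⟩ := abs_le.mp k4
    constructor <;> linarith

theorem weight_bounds (hm : 1 ≤ m) (hmn : m ^ 2 ≤ n) {p : unitInterval}
    (hp0 : 0 < p) (hp1 : p < 1) (hKn : 2 * K ≤ n) {D : ℝ} (hmK : (m : ℝ) * K ≤ D * n)
    (hsmall : shiftBound (p : ℝ)⁻¹ D ^ 2 * K ^ 3 ≤ ((p : ℝ)⁻¹ - 1) / 4 * n ^ 2)
    {μ : Measure (BipGraph n)} (hμ : IsPlanted n p K μ) {W : BipGraph n → Fin n → ℝ}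
    (hW : W = leftWeight (p : ℝ) m ∨ W = rightWeight (p : ℝ) m) :
    (∀ i, 1 ≤ ∫ G, W G i ∂μ ∧ ∫ G, W G i ∂μ ≤ meanBound (p : ℝ)⁻¹ D) ∧
    ∀ i j, i = j ∨ 2 ≤ m →
      ((p : ℝ)⁻¹ - 1) / 4 * (meanCommon m i j / n) ≤
        covariance (fun G => W G i) (fun G => W G j) μ ∧
      covariance (fun G => W G i) (fun G => W G j) μ ≤
        (4 * momentBound (p : ℝ)⁻¹ D + ((p : ℝ)⁻¹ - 1) / 4) * (meanCommon m i j / n) := by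
  have hmn' : m ≤ n := le_trans (by nlinarith) hmn
  have hKn' : K ≤ n := by omega
  rcases hW with rfl | rfl
  · exact ⟨mean_leftWeight_bounds hm hmn' hp0 hp1 hKn' hmK hμ,
      covariance_leftWeight_bounds hm hmn hp0 hp1 hKn hmK hsmall hμ⟩
  · have hmean : ∀ i, ∫ G, rightWeight p m G i ∂μ =
        ∫ G, leftWeight p m G i ∂(μ.map swapSides) := fun i =>
      (integral_map (f := fun G => leftWeight p m G i) Measurable.of_discrete.aemeasurable
        Measurable.of_discrete.aestronglyMeasurable).symm
    have hcov : ∀ i j, covariance (fun G => rightWeight p m G i) (fun G => rightWeight p m G j) μ =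
        covariance (fun G => leftWeight p m G i) (fun G => leftWeight p m G j)
          (μ.map swapSides) := fun i j =>
      (covariance_map_fun (X := fun G => leftWeight p m G i)
        (Y := fun G => leftWeight p m G j) Measurable.of_discrete.aestronglyMeasurable
        Measurable.of_discrete.aestronglyMeasurable Measurable.of_discrete.aemeasurable).symm
    simp only [hmean, hcov]
    exact ⟨mean_leftWeight_bounds hm hmn' hp0 hp1 hKn' hmK hμ.map_swapSides,
      covariance_leftWeight_bounds hm hmn hp0 hp1 hKn hmK hsmall hμ.map_swapSides⟩

end Bounds

/-! ### Asymptotics and the final constants. -/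

/-- `D` is the constant in `K ≤ D √n`. It is chosen before `a` and `c` because `a` is later taken to
be the square of `shiftBound`, which depends on `D`. -/
theorem eventually_size_bounds (m K : ℕ → ℕ)
    (hm : (fun n : ℕ => (m n : ℝ)) =o[atTop] fun n : ℕ => Real.sqrt (n : ℝ))
    (hK : (fun n : ℕ => (K n : ℝ)) =O[atTop] fun n : ℕ => Real.sqrt (n : ℝ)) :
    ∃ D : ℝ, 0 < D ∧ ∀ a c : ℝ, 0 ≤ a → 0 < c → ∀ᶠ n : ℕ in atTop, m n ^ 2 ≤ n ∧ 2 * K n ≤ n ∧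
      (m n : ℝ) * K n ≤ D * n ∧ a * (K n : ℝ) ^ 3 ≤ c * (n : ℝ) ^ 2 := by
  obtain ⟨D, hD, hKD⟩ := hK.exists_pos
  refine ⟨D, hD, fun a c ha hc => ?_⟩
  have hsqrt : Tendsto (fun n : ℕ => Real.sqrt (n : ℝ)) atTop atTop :=
    Real.tendsto_sqrt_atTop.comp tendsto_natCast_atTop_atTop
  filter_upwards [hm.def one_pos, hKD.bound, hsqrt.eventually_ge_atTop (2 * D),
    hsqrt.eventually_ge_atTop (a * D ^ 3 / c)] with n h1 h2 h3 h4
  rw [Real.norm_of_nonneg (by positivity), Real.norm_of_nonneg (by positivity)] at h1 h2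
  rw [one_mul] at h1
  have hs : Real.sqrt (n : ℝ) ^ 2 = n := Real.sq_sqrt (by positivity)
  set s := Real.sqrt (n : ℝ)
  have hs0 : 0 ≤ s := Real.sqrt_nonneg _
  rw [div_le_iff₀ hc] at h4
  refine ⟨?_, ?_, ?_, ?_⟩
  · have : (m n : ℝ) ^ 2 ≤ n := by rw [← hs]; gcongr
    exact_mod_cast this
  · have : 2 * (K n : ℝ) ≤ n := by rw [← hs]; nlinarith
    exact_mod_cast this
  · calc (m n : ℝ) * K n ≤ s * (D * s) := by gcongr
      _ = D * n := by rw [← hs]; ring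
  · calc a * (K n : ℝ) ^ 3 ≤ a * (D * s) ^ 3 := by gcongr
      _ = (a * D ^ 3) * s ^ 3 := by ring
      _ ≤ (s * c) * s ^ 3 := by gcongr
      _ = c * (n : ℝ) ^ 2 := by rw [← hs]; ring

theorem mainTheorem5 (p : unitInterval) (hp0 : 0 < p) (hp1 : p < 1) (m K : ℕ → ℕ)
    (hm1 : ∀ᶠ n in atTop, 1 ≤ m n)
    (hm : (fun n : ℕ => (m n : ℝ)) =o[atTop] fun n : ℕ => Real.sqrt (n : ℝ))
    (hK : (fun n : ℕ => (K n : ℝ)) =O[atTop] fun n : ℕ => Real.sqrt (n : ℝ)) :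
    ∃ c C : ℝ, 0 < c ∧ 0 < C ∧ ∀ᶠ n : ℕ in atTop,
      -- the graph: given planted sets of size `K`, or uniformly random ones
      ∀ μ : Measure (BipGraph n),
        ((∃ A₀ B₀ : Finset (Fin n), A₀.card = K n ∧ B₀.card = K n ∧ μ = plantedLaw n p A₀ B₀) ∨
          μ = randomPlantedLaw n p (K n)) →
      -- the side of the graph on which the vertices lie
      ∀ W : BipGraph n → Fin n → ℝ,
        (W = leftWeight (p : ℝ) (m n) ∨ W = rightWeight (p : ℝ) (m n)) →
        (∀ i : Fin n,
          c * ((1 / (n : ℝ)) * (∫ G, W G i ∂μ) ^ 2) ≤ variance (fun G => W G i) μ ∧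
          variance (fun G => W G i) μ ≤ C * ((1 / (n : ℝ)) * (∫ G, W G i ∂μ) ^ 2)) ∧
        (2 ≤ m n → ∀ i j : Fin n, i ≠ j →
          c * (((m n : ℝ) ^ 2 / (n : ℝ) ^ 2) * (∫ G, W G i ∂μ) ^ 2) ≤
            covariance (fun G => W G i) (fun G => W G j) μ ∧
          covariance (fun G => W G i) (fun G => W G j) μ ≤
            C * (((m n : ℝ) ^ 2 / (n : ℝ) ^ 2) * (∫ G, W G i ∂μ) ^ 2)) ∧
        (∀ i : Fin n,
          c * ((∫ G, W G i ∂μ) / Real.sqrt (n : ℝ)) ≤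
            Real.sqrt (variance (fun G => W G i) μ) ∧
          Real.sqrt (variance (fun G => W G i) μ) ≤
            C * ((∫ G, W G i ∂μ) / Real.sqrt (n : ℝ))) := by
  have h0 : (0 : ℝ) < p := hp0
  have h1 : (p : ℝ) < 1 := hp1
  have hL : 1 < (p : ℝ)⁻¹ := (one_lt_inv₀ h0).mpr h1
  obtain ⟨D, hD, hsize⟩ := eventually_size_bounds m K hm hK
  set c₀ := ((p : ℝ)⁻¹ - 1) / 4 with hc₀
  have hc₀pos : 0 < c₀ := by rw [hc₀]; linarith
  set M := meanBound (p : ℝ)⁻¹ D with hM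
  have hMpos : 0 < M := by rw [hM, meanBound]; positivity
  set C₀ := 4 * momentBound (p : ℝ)⁻¹ D + c₀ with hC₀
  have hC₀pos : 0 < C₀ := by
    have : 0 < (p : ℝ)⁻¹ ^ 3 - 1 := by
      have := one_lt_pow₀ hL (n := 3) (by norm_num); linarith
    rw [hC₀, momentBound]; positivity
  -- The factors 1/4 and 2 come from `m²/(4n) ≤ meanCommon ≤ 2m²/n` off the diagonal and cover the
  -- diagonal case. The power `M²` comes from the mean being at most `M`, while the upper bound uses
  -- that the mean is at least 1. The cut-offs at 1 give `c² ≤ c` and `C ≤ C²`, so the same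
  -- constants serve for the standard deviation.
  set c := min 1 (c₀ / 4 / M ^ 2) with hc
  set C := max 1 (2 * C₀) with hC
  have hcpos : 0 < c := lt_min one_pos (by positivity)
  have hCpos : 0 < C := lt_max_of_lt_left one_pos
  have hcM : c * M ^ 2 ≤ c₀ / 4 := by
    rw [← le_div_iff₀ (by positivity)]; exact min_le_right _ _
  refine ⟨c, C, hcpos, hCpos, ?_⟩
  filter_upwards [hm1, hsize _ c₀ (sq_nonneg (shiftBound (p : ℝ)⁻¹ D)) hc₀pos] with n hm1
    ⟨hmn, hKn, hmK, hsmall⟩ μ hμ W hW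
  obtain ⟨hmean, hcov⟩ := weight_bounds hm1 hmn hp0 hp1 hKn hmK hsmall hμ hW
  have hvar : ∀ i : Fin n,
      c * ((1 / (n : ℝ)) * (∫ G, W G i ∂μ) ^ 2) ≤ variance (fun G => W G i) μ ∧
      variance (fun G => W G i) μ ≤ C * ((1 / (n : ℝ)) * (∫ G, W G i ∂μ) ^ 2) := by
    intro i
    have hn : (0 : ℝ) < n := by exact_mod_cast i.pos
    obtain ⟨e1, e2⟩ := hmean i
    obtain ⟨v1, v2⟩ := hcov i i (Or.inl rfl)
    obtain ⟨r1, r2⟩ := meanCommon_self_bounds hm1 hmn i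
    rw [covariance_self Measurable.of_discrete.aemeasurable] at v1 v2
    set e := ∫ G, W G i ∂μ
    constructor
    · calc c * ((1 / (n : ℝ)) * e ^ 2) ≤ c * ((1 / (n : ℝ)) * M ^ 2) := by gcongr
        _ = (c * M ^ 2) * (1 / n) := by ring
        _ ≤ c₀ * (meanCommon (m n) i i / n) := by gcongr; linarith
        _ ≤ _ := v1
    · calc _ ≤ C₀ * (meanCommon (m n) i i / n) := v2
        _ ≤ C₀ * (2 / n) := by gcongr
        _ = (2 * C₀) * ((1 / n) * 1 ^ 2) := by ring
        _ ≤ C * ((1 / n) * e ^ 2) := by gcongr; exact le_max_right _ _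
  refine ⟨hvar, ?_, ?_⟩
  · intro hm2 i j hij
    have hn : (0 : ℝ) < n := by exact_mod_cast i.pos
    obtain ⟨e1, e2⟩ := hmean i
    obtain ⟨v1, v2⟩ := hcov i j (Or.inr hm2)
    obtain ⟨r1, r2⟩ := meanCommon_bounds_of_ne hm2 (le_trans (by nlinarith) hmn) hij
    set e := ∫ G, W G i ∂μ
    constructor
    · calc c * ((m n : ℝ) ^ 2 / n ^ 2 * e ^ 2) ≤ c * ((m n : ℝ) ^ 2 / n ^ 2 * M ^ 2) := by gcongr
        _ = (c * M ^ 2) * ((m n : ℝ) ^ 2 / n ^ 2) := by ring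
        _ ≤ c₀ / 4 * ((m n : ℝ) ^ 2 / n ^ 2) := by gcongr
        _ = c₀ * ((m n : ℝ) ^ 2 / (4 * n) / n) := by field_simp
        _ ≤ c₀ * (meanCommon (m n) i j / n) := by gcongr
        _ ≤ _ := v1
    · calc _ ≤ C₀ * (meanCommon (m n) i j / n) := v2
        _ ≤ C₀ * (2 * (m n : ℝ) ^ 2 / n / n) := by gcongr
        _ = (2 * C₀) * ((m n : ℝ) ^ 2 / n ^ 2 * 1 ^ 2) := by field_simp
        _ ≤ C * ((m n : ℝ) ^ 2 / n ^ 2 * e ^ 2) := by gcongr; exact le_max_right _ _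
  · intro i
    have hn : (0 : ℝ) < n := by exact_mod_cast i.pos
    obtain ⟨v1, v2⟩ := hvar i
    have e1 := (hmean i).1
    set e := ∫ G, W G i ∂μ
    have hsq : (e / Real.sqrt n) ^ 2 = 1 / n * e ^ 2 := by
      rw [div_pow, Real.sq_sqrt hn.le]; ring
    have he : 0 ≤ e / Real.sqrt n := by positivity
    rw [← hsq] at v1 v2
    constructor
    · refine Real.le_sqrt_of_sq_le (le_trans ?_ v1)
      rw [mul_pow]
      gcongr
      have : c ≤ 1 := min_le_left _ _
      nlinarith
    · refine Real.sqrt_le_iff.mpr ⟨by positivity, v2.trans ?_⟩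
      rw [mul_pow]
      gcongr
      have : 1 ≤ C := le_max_left _ _
      nlinarith
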